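/- Let $\Omega$ be a finite non-empty set of states, $p\in\Delta(\Omega)$ a prior with $p(\omega)>0$ for all $\omega$, $N$ a finite set of receivers, and for each $\omega\in\Omega$ let $v^\omega:\Delta(\Omega)^N\to\mathbb{R}$ be an upper semicontinuous utility of the sender. An information structure $I$ consists of a measurable space of signals $S_i$ for each $i\in N$ and of a probability distribution on $\prod_{i\in N}S_i$ for each state $\omega$. Together with $p$ it determines the posterior beliefs $x_i=\mathbb{P}_I(\,\cdot\mid s_i)\in\Delta(\Omega)$ of the receivers, their joint distribution $\mu_I^\omega\in\Delta(\Delta(\Omega)^N)$ conditional on each state $\omega$, and the sender's expected utility $\mathbb{E}_I[v^\omega((x_i)_{i\in N})]\in[-\infty,\infty)$. The value $\mathrm{Val}$ is the supremum of $\mathbb{E}_I[v^\omega((x_i)_{i\in N})]$ over all information structures $I$. Fix $\omega_0\in\Omega$ and suppose that the problem is a one-state problem: $v^{\omega}\equiv 0$ for all $\omega\ne\omega_0$. Write $v=v^{\omega_0}$. Let $\mathcal{F}$ be the set of all Borel probability measures $\pi$ on $\Delta(\Omega)^N$ whose marginals $\pi_i$, $i\in N$, satisfy $$\int_{\Delta(\Omega)}\frac{x(\omega)}{x(\omega_0)}\,\mathrm{d}\pi_i(x)\le\frac{p(\omega)}{p(\omega_0)}\qquad\text{for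 all }\omega\in\Omega\setminus\{\omega_0\},$$ where the integrand is $+\infty$ if $x(\omega_0)=0<x(\omega)$ and $0$ if $x(\omega_0)=x(\omega)=0$. For $\pi\in\mathcal{F}$ let $n_i(\pi)$ be the number of $\omega\neq\omega_0$ for which the inequality for $\pi_i$ is an equality, and let $n(\pi)=\sum_{i\in N}n_i(\pi)$. Then: 1. The supremum defining $\mathrm{Val}$ is attained and finite, and $$\mathrm{Val}=p(\omega_0)\cdot\max_{\pi\in\mathcal{F}}\int v\,\mathrm{d}\pi=p(\omega_0)\cdot\max_{\substack{\pi\in\mathcal{F}\\ |\mathrm{supp}\,\pi|\le|N|(|\Omega|-1)+1}}\int v\,\mathrm{d}\pi=p(\omega_0)\cdot\max_{\substack{\pi\in\mathcal{F}\\ |\mathrm{supp}\,\pi|\le n(\pi)+1}}\int v\,\mathrm{d}\pi,$$ where all the maxima are attained. 2. Every extreme point $\pi$ of $\mathcal{F}$ satisfies $|\mathrm{supp}\,\pi|\le n(\pi)+1$. 3. For every $\pi\in\mathcal{F}$ with finite support there is an information structure $I$ with $\mu_I^{\omega_0}=\pi$ and expected utility $p(\omega_0)\int v\,\mathrm{d}\pi$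 in which each receiver $i$ has at most $|\mathrm{supp}\,\pi_i|+|\Omega|-1-n_i(\pi)$ signals. In particular, every $\pi\in\mathcal{F}$ with $|\mathrm{supp}\,\pi|\le n(\pi)+1$ is implemented in this way by an information structure with at most $|N|(|\Omega|-1)+1$ signals per receiver. -/

import Mathlib

open MeasureTheory ProbabilityTheory
open scoped ENNReal NNReal

universe u v w

namespace Persuasion

/-- The space `Δ(Ω)` of beliefs about a finite state, with its Euclidean topology and the
induced (Borel) sigma-algebra. -/
abbrev Belief (Ω : Type*) [Fintype Ω] : Type _ := stdSimplex ℝ Ω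

/-- The probability measure on `Ω` with weights `p ω`. -/
noncomputable def beliefMeasure {Ω : Type*} [Fintype Ω] [MeasurableSpace Ω]
    (p : Belief Ω) : Measure Ω :=
  ∑ ω, ENNReal.ofReal (p.1 ω) • Measure.dirac ω

instance {Ω : Type*} [Fintype Ω] [MeasurableSpace Ω] (p : Belief Ω) :
    IsProbabilityMeasure (beliefMeasure p) := by
  constructor
  simp only [beliefMeasure, Measure.coe_finsetSum, Finset.sum_apply, Measure.smul_apply,
    measure_univ, smul_eq_mul, mul_one]
  rw [← ENNReal.ofReal_sum_of_nonneg (fun ω _ => p.2.1 ω), p.2.2, ENNReal.ofReal_one]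

/-- The integral of a real function whose positive part is integrable, as an element of
`[-∞, ∞)`: the integral of the positive part minus that of the negative part. -/
noncomputable def extIntegral {X : Type*} [MeasurableSpace X] (μ : Measure X) (f : X → ℝ) :
    EReal :=
  ((∫⁻ x, ENNReal.ofReal (f x) ∂μ : ℝ≥0∞) : EReal) -
    ((∫⁻ x, ENNReal.ofReal (-f x) ∂μ : ℝ≥0∞) : EReal)

/-- An information structure: a measurable space of signals for each receiver, and for each
state a joint distribution of the signals. -/
structure InfoStructure (Ω : Type u) [MeasurableSpace Ω] (N : Type v) where
  /-- the signals of each receiver -/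
  S : N → Type w
  /-- the sigma-algebra on the signals of each receiver -/
  mS : ∀ i, MeasurableSpace (S i)
  /-- the joint distribution of signals conditional on the state -/
  signal : Kernel Ω (∀ i, S i)
  isMarkov : IsMarkovKernel signal

attribute [instance] InfoStructure.mS InfoStructure.isMarkov

namespace InfoStructure

variable {Ω : Type u} [MeasurableSpace Ω] {N : Type v}

/-- The distribution of the signal of receiver `i` conditional on the state. -/
noncomputable def receiverSignal (I : InfoStructure.{u, v, w} Ω N) (i : N) : Kernel Ω (I.S i) :=
  I.signal.map (fun s => s i)

instance (I : InfoStructure.{u, v, w} Ω N) (i : N) : IsMarkovKernel (I.receiverSignal i) :=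
  Kernel.IsMarkovKernel.map _ (measurable_pi_apply i)

/-- Each receiver `i` has at most `k i` signals. -/
def UsesAtMost (I : InfoStructure.{u, v, w} Ω N) (k : N → ℕ) : Prop :=
  ∀ i, DiscreteMeasurableSpace (I.S i) ∧ Finite (I.S i) ∧ Nat.card (I.S i) ≤ k i

variable [Fintype Ω] [DiscreteMeasurableSpace Ω] [Nonempty Ω]

/-- The posterior belief of receiver `i` with prior `p` after the signal `s`:
`x_i(ω) = ℙ(ω | s)`, the conditional probability of the state given the signal. -/
noncomputable def belief (I : InfoStructure.{u, v, w} Ω N) (p : Belief Ω) (i : N) (s : I.S i) :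
    Belief Ω :=
  ⟨fun ω => (posterior (I.receiverSignal i) (beliefMeasure p) s).real {ω},
    fun _ => measureReal_nonneg, by
      rw [sum_measureReal_singleton, Finset.coe_univ]
      exact probReal_univ⟩

/-- The profile of posterior beliefs induced by a profile of signals. -/
noncomputable def beliefs (I : InfoStructure.{u, v, w} Ω N) (p : Belief Ω) (s : ∀ i, I.S i) :
    N → Belief Ω :=
  fun i => I.belief p i (s i)

/-- The joint distribution `μ_I^ω` of the posterior beliefs conditional on the state `ω`. -/
noncomputable def beliefLaw (I : InfoStructure.{u, v, w} Ω N) (p : Belief Ω) (ω : Ω) :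
    Measure (N → Belief Ω) :=
  (I.signal ω).map (I.beliefs p)

end InfoStructure

/-- A first-order Bayesian persuasion problem with set of states `Ω` and set of receivers `N`:
a prior with full support and, for each state, an upper semicontinuous utility of the sender
as a function of the receivers' beliefs. -/
structure Problem (Ω : Type u) [Fintype Ω] (N : Type v) where
  prior : Belief Ω
  prior_pos : ∀ ω, 0 < prior.1 ω
  utility : Ω → (N → Belief Ω) → ℝ
  usc : ∀ ω, UpperSemicontinuous (utility ω)

namespace Problem

variable {Ω : Type u} [Fintype Ω] {N : Type v}

/-- The sender's utility vanishes in all states but `ω₀`. -/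
def IsOneState (B : Problem Ω N) (ω₀ : Ω) : Prop :=
  ∀ ω, ω ≠ ω₀ → ∀ x, B.utility ω x = 0

section Value

variable [MeasurableSpace Ω] [DiscreteMeasurableSpace Ω] [Nonempty Ω]

/-- `𝔼_I[v^ω(x_1, …, x_n)]`, the expectation being over the joint distribution of the state
and the signals. -/
noncomputable def expectedUtility (B : Problem Ω N) (I : InfoStructure.{u, v, w} Ω N) : EReal :=
  extIntegral (beliefMeasure B.prior ⊗ₘ I.signal)
    (fun q => B.utility q.1 (I.beliefs B.prior q.2))

/-- The value of the problem: the supremum of the sender's expected utility over all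
information structures. -/
noncomputable def value (B : Problem Ω N) : EReal :=
  ⨆ I : InfoStructure.{u, v, w} Ω N, B.expectedUtility I

end Value

/-- `∫ x(ω) / x(ω₀) dπ_i(x)` for the marginal `π_i` of `π`, with values in `[0, ∞]`; the
integrand is `∞` where `x(ω₀) = 0 < x(ω)`. -/
noncomputable def ratioIntegral (ω₀ : Ω) (π : Measure (N → Belief Ω)) (i : N) (ω : Ω) : ℝ≥0∞ :=
  ∫⁻ x : Belief Ω, ENNReal.ofReal (x.1 ω) / ENNReal.ofReal (x.1 ω₀) ∂(π.map (fun y => y i))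

/-- The probability distributions on `Δ(Ω)^N` whose marginals `π_i` satisfy
`∫ x(ω) / x(ω₀) dπ_i(x) ≤ p(ω) / p(ω₀)` for all `ω ≠ ω₀`. -/
def oneStateFeasible (B : Problem Ω N) (ω₀ : Ω) : Set (Measure (N → Belief Ω)) :=
  {π | IsProbabilityMeasure π ∧ ∀ i, ∀ ω, ω ≠ ω₀ →
    ratioIntegral ω₀ π i ω ≤ ENNReal.ofReal (B.prior.1 ω / B.prior.1 ω₀)}

/-- The number of the inequalities of receiver `i` that hold as equalities. -/
noncomputable def activeCount (B : Problem Ω N) (ω₀ : Ω) (π : Measure (N → Belief Ω)) (i : N) :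
    ℕ :=
  {ω | ω ≠ ω₀ ∧
    ratioIntegral ω₀ π i ω = ENNReal.ofReal (B.prior.1 ω / B.prior.1 ω₀)}.ncard

end Problem

end Persuasion

/-! A law of beliefs in state `ω₀` is inducible exactly when it is feasible. For necessity, Bayes'
rule gives `p(ω₀) ∫ x(ω)/x(ω₀) dπ_i = 𝔼[x_i(ω); x_i(ω₀) > 0] ≤ p(ω)`. For sufficiency, Bayes' rule
prescribes the density `p(ω₀) x(ω) / (p(ω) x(ω₀))` with respect to `π_i` for the law of receiver
`i`'s belief in state `ω`. Feasibility says that this has mass at most one, and the missing mass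
goes to a signal that reveals `ω`. Only marginals matter in the states other than `ω₀`, so the
receivers can be treated independently there (`exists_infoStructure`). The problem becomes the
maximisation of `∫ v dπ` under finitely many moment constraints.

If the support has more than `n(π) + 1` points, the mass of disjoint neighbourhoods of `n(π) + 2` of
them can be shifted in a direction, and in its opposite, that preserves total mass and all active
moments; a small shift also respects the slack ones (`exists_perturbation`). Hence extreme points
have small support. An optimum exists because Carathéodory's theorem and lower semicontinuity reduce
any law to one with a fixed number of atoms (`exists_discreteMeasure_lintegral_le`), and such laws
have a compact parameter space. With the optimal atoms fixed, an extreme point of the set of optimal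
weights has small support by the same perturbation (`exists_momentFeasible_minimizer`). -/

open Filter Topology

/-- The product of lower semicontinuous functions with values in `[0, ∞]` is lower
semicontinuous. -/
theorem LowerSemicontinuous.ennreal_mul {X : Type*} [TopologicalSpace X] {f g : X → ℝ≥0∞}
    (hf : LowerSemicontinuous f) (hg : LowerSemicontinuous g) :
    LowerSemicontinuous (fun x => f x * g x) := by
  intro x y hy
  have hfx : f x ≠ 0 := by rintro h; simp [h] at hy
  have hgx : g x ≠ 0 := by rintro h; simp [h] at hy
  have hc : Tendsto (fun p : ℝ≥0∞ × ℝ≥0∞ => p.1 * p.2) (𝓝 (f x) ×ˢ 𝓝 (g x))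
      (𝓝 (f x * g x)) := by
    rw [← nhds_prod_eq]; exact ENNReal.tendsto_mul (Or.inl hfx) (Or.inl hgx)
  obtain ⟨s, hs, t, ht, hst⟩ := Filter.mem_prod_iff.1 (hc.eventually (lt_mem_nhds hy))
  obtain ⟨a, ha, has⟩ := exists_Ioc_subset_of_mem_nhds hs ⟨0, pos_iff_ne_zero.2 hfx⟩
  obtain ⟨b, hb, hbt⟩ := exists_Ioc_subset_of_mem_nhds ht ⟨0, pos_iff_ne_zero.2 hgx⟩
  filter_upwards [hf x a ha, hg x b hb] with z hz hz'
  have : y < min (f z) (f x) * min (g z) (g x) :=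
    hst (Set.mk_mem_prod (has ⟨lt_min hz ha, min_le_right _ _⟩)
      (hbt ⟨lt_min hz' hb, min_le_right _ _⟩))
  exact this.trans_le (mul_le_mul' (min_le_left _ _) (min_le_left _ _))

/-! ### Perturbation of measures under moment constraints -/

section MomentProblem

variable {X : Type*} [MeasurableSpace X] {ι : Type*}

/-- The probability measures whose moments with respect to the functions `r j` are bounded by
`c j`. -/
def momentFeasible (r : ι → X → ℝ≥0∞) (c : ι → ℝ≥0∞) : Set (Measure X) :=
  {π | IsProbabilityMeasure π ∧ ∀ j, ∫⁻ x, r j x ∂π ≤ c j}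

/-- The moment constraints that hold as equalities. -/
def activeConstraints (r : ι → X → ℝ≥0∞) (c : ι → ℝ≥0∞) (π : Measure X) : Set ι :=
  {j | ∫⁻ x, r j x ∂π = c j}

/-- The bound on `h` keeps the density `1 + h` nonnegative, so the perturbed moment is affine in `h`
and linear algebra over the reals applies to it. -/
theorem lintegral_mul_ofReal_one_add {π : Measure X} {f : X → ℝ≥0∞} (hf : Measurable f)
    (hfi : ∫⁻ x, f x ∂π ≠ ∞) {h : X → ℝ} (hh : Measurable h) (h1 : ∀ x, |h x| ≤ 1) :
    ∫⁻ x, f x * ENNReal.ofReal (1 + h x) ∂π =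
      ENNReal.ofReal ((∫⁻ x, f x ∂π).toReal + ∫ x, (f x).toReal * h x ∂π) := by
  have hfin : ∀ᵐ x ∂π, f x < ∞ := ae_lt_top hf hfi
  have hint : Integrable (fun x => (f x).toReal) π :=
    integrable_toReal_of_lintegral_ne_top hf.aemeasurable hfi
  have hint' : Integrable (fun x => (f x).toReal * h x) π :=
    hint.mul_bdd (c := 1) hh.aestronglyMeasurable (ae_of_all _ h1)
  have hnn : 0 ≤ᵐ[π] fun x => (f x).toReal + (f x).toReal * h x := by
    refine ae_of_all _ fun x => ?_
    have := abs_le.1 (h1 x)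
    simp only [Pi.zero_apply, ← mul_one_add]
    exact mul_nonneg ENNReal.toReal_nonneg (by linarith)
  rw [← integral_toReal hf.aemeasurable hfin, ← integral_add hint hint']
  refine Eq.trans ?_ (ofReal_integral_eq_lintegral_ofReal (hint.add hint') hnn).symm
  refine lintegral_congr_ae ?_
  filter_upwards [hfin] with x hx
  rw [Pi.add_apply, ← mul_one_add, ENNReal.ofReal_mul ENNReal.toReal_nonneg, ENNReal.ofReal_toReal hx.ne]

theorem integral_toReal_mul_sum_indicator {π : Measure X} {f : X → ℝ≥0∞} (hf : Measurable f)
    (hfi : ∫⁻ x, f x ∂π ≠ ∞) {κ : Type*} [Fintype κ] (d : κ → ℝ) {U : κ → Set X}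
    (hU : ∀ a, MeasurableSet (U a)) :
    ∫ x, (f x).toReal * ∑ a, (U a).indicator (fun _ => d a) x ∂π =
      ∑ a, (∫⁻ x in U a, f x ∂π).toReal * d a := by
  have hint : Integrable (fun x => (f x).toReal) π :=
    integrable_toReal_of_lintegral_ne_top hf.aemeasurable hfi
  have heq : ∀ a x, (f x).toReal * (U a).indicator (fun _ => d a) x =
      (U a).indicator (fun x => (f x).toReal * d a) x := by
    intro a x
    by_cases hx : x ∈ U a <;> simp [hx]
  simp_rw [Finset.mul_sum, heq]
  rw [integral_finsetSum _ fun a _ => (hint.mul_const _).indicator (hU a)]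
  refine Finset.sum_congr rfl fun a _ => ?_
  rw [integral_indicator (hU a), integral_mul_const,
    integral_toReal hf.aemeasurable (ae_restrict_of_ae (ae_lt_top hf hfi))]

variable [TopologicalSpace X] [T2Space X] [OpensMeasurableSpace X] [Finite ι]

/-- A feasible measure with more than `n + 1` points in its support, where `n` is the number of
active constraints, can be perturbed within the feasible set. -/
theorem exists_perturbation {r : ι → X → ℝ≥0∞} {c : ι → ℝ≥0∞} (hr : ∀ j, Measurable (r j))
    (hc : ∀ j, c j ≠ ∞) {π : Measure X} (hπ : π ∈ momentFeasible r c)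
    (hsupp : (((activeConstraints r c π).ncard + 1 : ℕ) : ℕ∞) < π.support.encard) :
    ∃ h : X → ℝ, Measurable h ∧ (∀ x, |h x| ≤ 1) ∧ ¬ (h =ᵐ[π] 0) ∧
      ∀ s : ℝ, |s| ≤ 1 →
        π.withDensity (fun x => ENNReal.ofReal (1 + s * h x)) ∈ momentFeasible r c := by
  classical
  have := hπ.1
  set A := activeConstraints r c π with hA
  have hI : ∀ j, ∫⁻ x, r j x ∂π ≠ ∞ := fun j => ne_top_of_le_ne_top (hc j) (hπ.2 j)
  -- `n + 2` support points against `n + 1` linear conditions: the total mass (row `none`) and the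
  -- `n` active moments. So the matrix `M` below has a nonzero kernel vector.
  obtain ⟨T, hTs, hT⟩ := Set.exists_subset_encard_eq
    (k := ((A.ncard + 2 : ℕ) : ℕ∞)) (Order.add_one_le_of_lt hsupp)
  have hTf : T.Finite := Set.finite_of_encard_eq_coe hT
  obtain ⟨U, hU, hdisj⟩ := hTf.t2_separation
  have := hTf.fintype
  have := Fintype.ofFinite A
  have hUm : ∀ a : T, MeasurableSet (U a) := fun a => (hU a).2.measurableSet
  have hUpos : ∀ a : T, 0 < π (U a) := fun a =>
    (Measure.mem_support_iff_forall _).1 (hTs a.2) _ ((hU a).2.mem_nhds (hU a).1)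
  let M : Matrix (Option A) T ℝ := fun o a =>
    (∫⁻ x in U a, (o.elim (fun _ => 1) (fun j => r j)) x ∂π).toReal
  have hker : LinearMap.ker M.mulVecLin ≠ ⊥ := by
    apply LinearMap.ker_ne_bot_of_finrank_lt
    rw [Module.finrank_fintype_fun_eq_card, Module.finrank_fintype_fun_eq_card,
      Fintype.card_option, ← Nat.card_eq_fintype_card, ← Nat.card_eq_fintype_card,
      Nat.card_coe_set_eq, Nat.card_coe_set_eq]
    have : T.ncard = A.ncard + 2 := by rw [Set.ncard, hT]; rfl
    omega
  obtain ⟨d, hdker, hd0⟩ := (Submodule.ne_bot_iff _).1 hker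
  have hd : ∀ o, ∑ a, M o a * d a = 0 := fun o => congrFun (LinearMap.mem_ker.1 hdker) o
  obtain ⟨a₀, ha₀⟩ := Function.ne_iff.1 hd0
  -- A density of at most `1 + δ` cannot exhaust the slack of the finitely many inactive
  -- constraints.
  obtain ⟨δ, ⟨hδA, hδ1⟩, hδ0⟩ : ∃ δ : ℝ,
      ((∀ j, j ∉ A → ENNReal.ofReal (1 + δ) * ∫⁻ x, r j x ∂π < c j) ∧ δ < 1) ∧ 0 < δ := by
    have h0 : ∀ᶠ δ : ℝ in 𝓝 0,
        (∀ j, j ∉ A → ENNReal.ofReal (1 + δ) * ∫⁻ x, r j x ∂π < c j) ∧ δ < 1 := by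
      refine (eventually_all.2 fun j => ?_).and (gt_mem_nhds one_pos)
      by_cases hj : j ∈ A
      · simp [hj]
      have ht : Tendsto (fun δ : ℝ => ENNReal.ofReal (1 + δ) * ∫⁻ x, r j x ∂π) (𝓝 0)
          (𝓝 (∫⁻ x, r j x ∂π)) := by
        have : Tendsto (fun δ : ℝ => ENNReal.ofReal (1 + δ)) (𝓝 0) (𝓝 1) := by
          have : Continuous (fun δ : ℝ => ENNReal.ofReal (1 + δ)) :=
            ENNReal.continuous_ofReal.comp (by fun_prop)
          simpa using this.tendsto 0
        simpa using ENNReal.Tendsto.mul_const this (Or.inr (hI j))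
      filter_upwards [ht.eventually (gt_mem_nhds ((hπ.2 j).lt_of_ne hj))] with δ hδ _ using hδ
    exact ((h0.filter_mono nhdsWithin_le_nhds).and
      (self_mem_nhdsWithin : Set.Ioi (0 : ℝ) ∈ 𝓝[>] 0)).exists
  let D : ℝ := ∑ a, |d a|
  have hD : 0 < D := (abs_pos.2 ha₀).trans_le
    (Finset.single_le_sum (f := fun a => |d a|) (fun a _ => abs_nonneg _) (Finset.mem_univ a₀))
  let h₀ : X → ℝ := fun x => ∑ a, (U (a : T)).indicator (fun _ => d a) x
  have hh₀ : Measurable h₀ :=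
    Finset.measurable_fun_sum _ fun a _ => measurable_const.indicator (hUm a)
  have hh₀D : ∀ x, |h₀ x| ≤ D := by
    intro x
    refine (Finset.abs_sum_le_sum_abs _ _).trans (Finset.sum_le_sum fun a _ => ?_)
    by_cases hx : x ∈ U (a : X) <;> simp [hx]
  have hbound : ∀ x, |δ / D * h₀ x| ≤ δ := by
    intro x
    rw [abs_mul, abs_of_pos (div_pos hδ0 hD), div_mul_eq_mul_div, div_le_iff₀ hD]
    exact mul_le_mul_of_nonneg_left (hh₀D x) hδ0.le
  refine ⟨fun x => δ / D * h₀ x, hh₀.const_mul _, fun x => (hbound x).trans hδ1.le, ?_, ?_⟩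
  · intro hzero
    have hnull : π (U a₀) = 0 := by
      refine measure_mono_null (fun x hx => ?_) hzero
      have hx0 : h₀ x = d a₀ := by
        refine (Finset.sum_eq_single a₀ (fun b _ hb => ?_) (by simp)).trans (by simp [hx])
        refine Set.indicator_of_notMem (fun hxb => ?_) _
        exact Set.disjoint_left.1 (hdisj b.2 a₀.2 (fun h => hb (Subtype.ext h))) hxb hx
      simp only [Set.mem_compl_iff, Set.mem_ofPred_eq, Pi.zero_apply, hx0, mul_eq_zero, not_or]
      exact ⟨(div_pos hδ0 hD).ne', ha₀⟩
    exact (hUpos a₀).ne' hnull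
  · intro s hs
    have hsb : ∀ x, |s * (δ / D * h₀ x)| ≤ δ := fun x => by
      rw [abs_mul]
      exact (mul_le_mul hs (hbound x) (abs_nonneg _) zero_le_one).trans_eq (one_mul _)
    have hsm : Measurable fun x => s * (δ / D * h₀ x) := (hh₀.const_mul _).const_mul _
    have key : ∀ o : Option A, ∫⁻ x, (o.elim (fun _ => 1) (fun j => r j)) x *
        ENNReal.ofReal (1 + s * (δ / D * h₀ x)) ∂π =
          ∫⁻ x, (o.elim (fun _ => 1) (fun j => r j)) x ∂π := by
      intro o
      have hm : Measurable (o.elim (fun _ => (1 : ℝ≥0∞)) (fun j => r j)) := by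
        cases o with
        | none => exact measurable_const
        | some j => exact hr j
      have hfi : ∫⁻ x, (o.elim (fun _ => (1 : ℝ≥0∞)) (fun j => r j)) x ∂π ≠ ∞ := by
        cases o with
        | none => simp
        | some j => exact hI j
      rw [lintegral_mul_ofReal_one_add hm hfi hsm (fun x => (hsb x).trans hδ1.le)]
      have : ∀ x, ((o.elim (fun _ => (1 : ℝ≥0∞)) (fun j => r j)) x).toReal *
          (s * (δ / D * h₀ x)) = (s * (δ / D)) *
            (((o.elim (fun _ => (1 : ℝ≥0∞)) (fun j => r j)) x).toReal * h₀ x) := fun x => by ring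
      simp_rw [this]
      rw [integral_const_mul, integral_toReal_mul_sum_indicator hm hfi d hUm, hd o, mul_zero,
        add_zero, ENNReal.ofReal_toReal hfi]
    have hdm : Measurable fun x => ENNReal.ofReal (1 + s * (δ / D * h₀ x)) :=
      (hsm.const_add 1).ennreal_ofReal
    refine ⟨⟨?_⟩, fun j => ?_⟩
    · have := key none
      simp only [Option.elim_none, one_mul, lintegral_one, measure_univ] at this
      rw [withDensity_apply _ MeasurableSet.univ, Measure.restrict_univ, this]
    · rw [lintegral_withDensity_eq_lintegral_mul _ hdm (hr j)]
      simp only [Pi.mul_apply, mul_comm (ENNReal.ofReal _)]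
      by_cases hj : j ∈ A
      · exact (key (some ⟨j, hj⟩)).trans_le (hπ.2 j)
      · calc ∫⁻ x, r j x * ENNReal.ofReal (1 + s * (δ / D * h₀ x)) ∂π
            ≤ ∫⁻ x, r j x * ENNReal.ofReal (1 + δ) ∂π := by
              refine lintegral_mono fun x => ?_
              gcongr
              exact (le_abs_self _).trans (hsb x)
          _ = ENNReal.ofReal (1 + δ) * ∫⁻ x, r j x ∂π := by
              rw [lintegral_mul_const _ (hr j), mul_comm]
          _ ≤ c j := (hδA j hj).le

/-- Exhibits `π` as the midpoint of its two opposite perturbations. -/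
theorem withDensity_add_withDensity_sub {X : Type*} [MeasurableSpace X] {π : Measure X}
    {h : X → ℝ} (hh : Measurable h) (h1 : ∀ x, |h x| ≤ 1) :
    π.withDensity (fun x => ENNReal.ofReal (1 + 1 * h x)) +
      π.withDensity (fun x => ENNReal.ofReal (1 + -1 * h x)) = (2 : ℝ≥0) • π := by
  rw [← withDensity_add_left (by fun_prop)]
  have : (fun x => ENNReal.ofReal (1 + 1 * h x)) + (fun x => ENNReal.ofReal (1 + -1 * h x)) =
      fun _ => 2 := by
    ext x
    have := abs_le.1 (h1 x)
    rw [Pi.add_apply, ← ENNReal.ofReal_add (by linarith) (by linarith)]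
    ring_nf
    simp
  rw [this, withDensity_const]
  ext s _
  simp

/-- With a larger support, `π` would be the midpoint of two feasible perturbations. Extremality then
forces the density `1 + h` to be `1` almost everywhere, against the choice of `h`. -/
theorem encard_support_le_of_mem_extremePoints {r : ι → X → ℝ≥0∞} {c : ι → ℝ≥0∞}
    (hr : ∀ j, Measurable (r j)) (hc : ∀ j, c j ≠ ∞) {π : Measure X}
    (hπ : π ∈ Set.extremePoints ℝ≥0 (momentFeasible r c)) :
    π.support.encard ≤ (((activeConstraints r c π).ncard + 1 : ℕ) : ℕ∞) := by
  by_contra! hlt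
  obtain ⟨h, hh, h1, hne, hfeas⟩ := exists_perturbation hr hc hπ.1 hlt
  have := hπ.1.1
  have hseg : π ∈ openSegment ℝ≥0 (π.withDensity fun x => ENNReal.ofReal (1 + 1 * h x))
      (π.withDensity fun x => ENNReal.ofReal (1 + -1 * h x)) := by
    refine ⟨2⁻¹, 2⁻¹, by positivity, by positivity, ?_, ?_⟩
    · rw [← two_mul, mul_inv_cancel₀ two_ne_zero]
    · rw [← smul_add, withDensity_add_withDensity_sub hh h1, smul_smul,
        inv_mul_cancel₀ two_ne_zero, one_smul]
  have heq := hπ.2 (hfeas 1 (by simp)) (hfeas (-1) (by simp)) hseg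
  apply hne
  have heq' : π.withDensity (fun x => ENNReal.ofReal (1 + 1 * h x)) =
      π.withDensity (fun _ => 1) := by rw [heq, withDensity_const, one_smul]
  rw [withDensity_eq_iff (by fun_prop) (by fun_prop)] at heq'
  · filter_upwards [heq'] with x hx
    rw [ENNReal.ofReal_eq_one] at hx
    simpa using hx
  · rw [← setLIntegral_univ, ← withDensity_apply _ MeasurableSet.univ, heq]
    exact measure_ne_top _ _

end MomentProblem

/-! ### Measures with finitely many atoms -/

section DiscreteMeasure

variable {X : Type*} [MeasurableSpace X] {κ : Type*} [Fintype κ]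

/-- The measure with mass `w a` at the point `x a`. -/
noncomputable def discreteMeasure (w : κ → ℝ) (x : κ → X) : Measure X :=
  ∑ a, ENNReal.ofReal (w a) • Measure.dirac (x a)

theorem lintegral_discreteMeasure (w : κ → ℝ) (x : κ → X) {f : X → ℝ≥0∞} (hf : Measurable f) :
    ∫⁻ y, f y ∂(discreteMeasure w x) = ∑ a, ENNReal.ofReal (w a) * f (x a) := by
  simp [discreteMeasure, lintegral_finsetSum_measure, lintegral_smul_measure,
    lintegral_dirac' _ hf]

theorem isProbabilityMeasure_discreteMeasure {w : κ → ℝ} (hw : w ∈ stdSimplex ℝ κ) (x : κ → X) :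
    IsProbabilityMeasure (discreteMeasure w x) := by
  constructor
  simp only [discreteMeasure, Measure.coe_finsetSum, Finset.sum_apply, Measure.smul_apply,
    measure_univ, smul_eq_mul, mul_one]
  rw [← ENNReal.ofReal_sum_of_nonneg (fun a _ => hw.1 a), hw.2, ENNReal.ofReal_one]

theorem withDensity_discreteMeasure {w : κ → ℝ} (hw : ∀ a, 0 ≤ w a) (x : κ → X) {h : X → ℝ}
    (hh : Measurable h) :
    (discreteMeasure w x).withDensity (fun y => ENNReal.ofReal (h y)) =
      discreteMeasure (fun a => w a * h (x a)) x := by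
  ext s hs
  rw [withDensity_apply _ hs, ← lintegral_indicator hs,
    lintegral_discreteMeasure _ _ (hh.ennreal_ofReal.indicator hs)]
  simp only [discreteMeasure, Measure.coe_finsetSum, Finset.sum_apply, Measure.smul_apply,
    smul_eq_mul, Measure.dirac_apply' _ hs]
  refine Finset.sum_congr rfl fun a _ => ?_
  rw [ENNReal.ofReal_mul (hw a)]
  by_cases hx : x a ∈ s <;> simp [hx]

theorem ae_discreteMeasure_of_forall {w : κ → ℝ} {x : κ → X} {p : X → Prop}
    (hp : MeasurableSet {y | p y}) (h : ∀ a, 0 < w a → p (x a)) :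
    ∀ᵐ y ∂(discreteMeasure w x), p y := by
  rw [ae_iff]
  simp only [discreteMeasure, Measure.coe_finsetSum, Finset.sum_apply, Measure.smul_apply,
    smul_eq_mul]
  refine Finset.sum_eq_zero fun a _ => ?_
  rcases le_or_gt (w a) 0 with ha | ha
  · simp [ENNReal.ofReal_of_nonpos ha]
  · rw [show {y | ¬ p y} = {y | p y}ᶜ from rfl, Measure.dirac_apply' _ hp.compl, Set.indicator_of_notMem (by simpa using h a ha), mul_zero]

variable [TopologicalSpace X] [OpensMeasurableSpace X]

/-- Joint semicontinuity in weights and atoms lets compactness be used on the parameters, without a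
topology on the measures. -/
theorem lowerSemicontinuous_lintegral_discreteMeasure {f : X → ℝ≥0∞}
    (hf : LowerSemicontinuous f) :
    LowerSemicontinuous fun q : stdSimplex ℝ κ × (κ → X) =>
      ∫⁻ y, f y ∂(discreteMeasure q.1.1 q.2) := by
  simp_rw [lintegral_discreteMeasure _ _ hf.measurable]
  refine lowerSemicontinuous_sum fun a _ => LowerSemicontinuous.ennreal_mul ?_ ?_
  · refine (ENNReal.continuous_ofReal.comp ?_).lowerSemicontinuous
    exact (continuous_apply a).comp (continuous_subtype_val.comp continuous_fst)
  · exact hf.comp ((continuous_apply a).comp continuous_snd)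

end DiscreteMeasure

/-! ### Existence of an optimum with few atoms -/

section Optimum

variable {X : Type*} [TopologicalSpace X] [CompactSpace X] [MeasurableSpace X]
  [OpensMeasurableSpace X]

/-- Finitely many lower semicontinuous moments of a probability measure on a compact space are
bounded below by those of a probability measure with finitely many atoms. -/
theorem exists_discreteMeasure_lintegral_le {ι : Type*} [Fintype ι] {f : ι → X → ℝ≥0∞}
    (hf : ∀ j, LowerSemicontinuous (f j)) (π : Measure X) [IsProbabilityMeasure π]
    (hfi : ∀ j, ∫⁻ y, f j y ∂π ≠ ∞) :
    ∃ q : stdSimplex ℝ (Fin (Fintype.card ι + 1)) × (Fin (Fintype.card ι + 1) → X),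
      ∀ j, ∫⁻ y, f j y ∂(discreteMeasure q.1.1 q.2) ≤ ∫⁻ y, f j y ∂π := by
  classical
  obtain ⟨x₀⟩ : Nonempty X := nonempty_of_isProbabilityMeasure π
  let Q := stdSimplex ℝ (Fin (Fintype.card ι + 1)) × (Fin (Fintype.card ι + 1) → X)
  -- Moments are only lower semicontinuous, so the set of attained moment vectors need not be
  -- closed. The set of vectors that dominate them is: it is the projection of a closed set along
  -- the compact `Q`.
  let S : Set (ι → ℝ) := {y | ∃ q : Q, ∀ j,
    ∫⁻ y, f j y ∂(discreteMeasure q.1.1 q.2) ≤ ENNReal.ofReal (y j)}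
  have hS : IsClosed S := by
    have hcl : IsClosed {p : Q × (ι → ℝ) | ∀ j,
        ∫⁻ y, f j y ∂(discreteMeasure p.1.1.1 p.1.2) ≤ ENNReal.ofReal (p.2 j)} := by
      simp only [Set.ofPred_forall]
      refine isClosed_iInter fun j => ?_
      refine (lowerSemicontinuous_lintegral_discreteMeasure
        (κ := Fin (Fintype.card ι + 1)) (hf j)).isClosed_epigraph.preimage
        (f := fun p : Q × (ι → ℝ) => (p.1, ENNReal.ofReal (p.2 j))) ?_
      exact continuous_fst.prodMk
        (ENNReal.continuous_ofReal.comp ((continuous_apply j).comp continuous_snd))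
    convert! isClosedMap_snd_of_compactSpace _ hcl using 1
    ext y
    simp [S]
  let F : X → ι → ℝ := fun x j => (f j x).toReal
  let G : Set X := {x | ∀ j, f j x ≠ ∞}
  have hhull : convexHull ℝ (F '' G) ⊆ S := by
    -- Carathéodory: an affinely independent family in `ι → ℝ` has at most `card ι + 1` points.
    -- Unused atoms are placed at `x₀` with weight zero.
    intro y hy
    obtain ⟨ι', _, z, w, hz, hind, hw0, hw1, rfl⟩ := eq_pos_convex_span_of_mem_convexHull hy
    have hz' : ∀ i, ∃ x ∈ G, F x = z i := fun i => hz ⟨i, rfl⟩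
    choose x hxG hxz using hz'
    have hcard : Fintype.card ι' ≤ Fintype.card (Fin (Fintype.card ι + 1)) := by
      rw [Fintype.card_fin]
      refine hind.card_le_finrank_succ.trans (Nat.succ_le_succ ?_)
      exact (Submodule.finrank_le _).trans (Module.finrank_fintype_fun_eq_card ℝ).le
    obtain ⟨e⟩ := Function.Embedding.nonempty_of_card_le hcard
    have hsum : ∀ {M : Type} [AddCommMonoid M] (φ : ℝ → X → M), (∀ x, φ 0 x = 0) →
        ∑ a, φ (Function.extend e w 0 a) (Function.extend e x (fun _ => x₀) a) =
          ∑ i, φ (w i) (x i) := by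
      intro M _ φ hφ
      refine (Finset.sum_of_injOn e e.injective.injOn (by simp) (fun a _ ha => ?_)
        (fun i _ => ?_)).symm
      · rw [Function.extend_apply' _ _ _ (by simpa using ha), Pi.zero_apply, hφ]
      · rw [e.injective.extend_apply, e.injective.extend_apply]
    refine ⟨⟨⟨Function.extend e w 0, fun a => ?_, ?_⟩, Function.extend e x fun _ => x₀⟩,
      fun j => ?_⟩
    · by_cases ha : ∃ i, e i = a
      · obtain ⟨i, rfl⟩ := ha
        rw [e.injective.extend_apply]
        exact (hw0 i).le
      · rw [Function.extend_apply' _ _ _ ha, Pi.zero_apply]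
    · rw [hsum (fun t _ => t) (fun _ => rfl), hw1]
    · rw [lintegral_discreteMeasure _ _ (hf j).measurable,
        hsum (fun t y => ENNReal.ofReal t * f j y) (by simp), Finset.sum_apply,
        ENNReal.ofReal_sum_of_nonneg]
      · refine Finset.sum_le_sum fun i _ => ?_
        rw [Pi.smul_apply, smul_eq_mul, ENNReal.ofReal_mul (hw0 i).le, ← hxz i,
          ENNReal.ofReal_toReal (hxG i j)]
      · intro i _
        rw [← hxz i]
        exact mul_nonneg (hw0 i).le ENNReal.toReal_nonneg
  have hae : ∀ᵐ x ∂π, ∀ j, f j x < ∞ :=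
    ae_all_iff.2 fun j => ae_lt_top (hf j).measurable (hfi j)
  have hFi : ∀ j, Integrable (fun x => F x j) π := fun j =>
    integrable_toReal_of_lintegral_ne_top (hf j).measurable.aemeasurable (hfi j)
  -- The moment vector of `π` is a barycentre of values of `F` on `G`, a set of full measure, and so
  -- lies in the closed convex hull.
  have hmem : ∫ x, F x ∂π ∈ S := by
    refine closure_minimal hhull hS ?_
    refine (convex_convexHull ℝ _).closure.integral_mem isClosed_closure ?_ (Integrable.of_eval hFi)
    filter_upwards [hae] with x hx
    exact subset_closure (subset_convexHull ℝ _ ⟨x, fun j => (hx j).ne, rfl⟩)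
  obtain ⟨q, hq⟩ := hmem
  refine ⟨q, fun j => (hq j).trans_eq ?_⟩
  rw [eval_integral hFi, integral_toReal (hf j).measurable.aemeasurable
    (hae.mono fun x hx => hx j), ENNReal.ofReal_toReal (hfi j)]

variable [T2Space X] {ι : Type*} [Finite ι]

/-- A lower semicontinuous cost is minimised over the probability measures with given moment
bounds by a measure with at most `n + 1` atoms, where `n` is the number of active constraints. -/
theorem exists_momentFeasible_minimizer {r : ι → X → ℝ≥0∞} {c : ι → ℝ≥0∞}
    (hr : ∀ j, LowerSemicontinuous (r j)) (hc : ∀ j, c j ≠ ∞) {g : X → ℝ≥0∞}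
    (hg : LowerSemicontinuous g) (hfin : ∃ π ∈ momentFeasible r c, ∫⁻ x, g x ∂π ≠ ∞) :
    ∃ π ∈ momentFeasible r c,
      π.support.encard ≤ (((activeConstraints r c π).ncard + 1 : ℕ) : ℕ∞) ∧
      ∀ π' ∈ momentFeasible r c, ∫⁻ x, g x ∂π ≤ ∫⁻ x, g x ∂π' := by
  have := Fintype.ofFinite ι
  -- The cost `g` counts as one more moment, indexed by `none`.
  let κ := Fin (Fintype.card (Option ι) + 1)
  let Q := stdSimplex ℝ κ × (κ → X)
  have hred : ∀ π ∈ momentFeasible r c, ∫⁻ x, g x ∂π ≠ ∞ → ∃ q : Q,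
      discreteMeasure q.1.1 q.2 ∈ momentFeasible r c ∧
        ∫⁻ x, g x ∂(discreteMeasure q.1.1 q.2) ≤ ∫⁻ x, g x ∂π := by
    intro π hπ hgπ
    have := hπ.1
    obtain ⟨q, hq⟩ := exists_discreteMeasure_lintegral_le
      (f := fun o : Option ι => o.elim g r)
      (by rintro (_ | j); exacts [hg, hr j]) π
      (by rintro (_ | j); exacts [hgπ, ne_top_of_le_ne_top (hc j) (hπ.2 j)])
    exact ⟨q, ⟨isProbabilityMeasure_discreteMeasure q.1.2 _,
      fun j => (hq (some j)).trans (hπ.2 j)⟩, hq none⟩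
  let K : Set Q := {q | ∀ j, ∫⁻ x, r j x ∂(discreteMeasure q.1.1 q.2) ≤ c j}
  have hKc : IsClosed K := by
    simp only [K, Set.ofPred_forall]
    exact isClosed_iInter fun j =>
      (lowerSemicontinuous_lintegral_discreteMeasure (κ := κ) (hr j)).isClosed_preimage (c j)
  obtain ⟨π₀, hπ₀, hgπ₀⟩ := hfin
  obtain ⟨q₀, hq₀, hgq₀⟩ := hred π₀ hπ₀ hgπ₀
  obtain ⟨⟨⟨w, hw⟩, x⟩, hqK, hqmin⟩ := LowerSemicontinuousOn.exists_isMinOn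
    (s := K) ⟨q₀, hq₀.2⟩ hKc.isCompact
    ((lowerSemicontinuous_lintegral_discreteMeasure (κ := κ) hg).lowerSemicontinuousOn K)
  set opt := ∫⁻ y, g y ∂(discreteMeasure w x) with hopt
  have hopt_le : ∀ π ∈ momentFeasible r c, opt ≤ ∫⁻ y, g y ∂π := by
    intro π hπ
    rcases eq_or_ne (∫⁻ y, g y ∂π) ∞ with h | h
    · rw [h]; exact le_top
    · obtain ⟨q, hq, hle⟩ := hred π hπ h
      exact (hqmin hq.2).trans hle
  have hopt_fin : opt ≠ ∞ := ne_top_of_le_ne_top hgπ₀ (hopt_le _ hπ₀)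
  -- The optimal weights for the fixed atoms `x` form a compact set in finite dimension, which has
  -- an extreme point.
  let W : Set (κ → ℝ) := {w | w ∈ stdSimplex ℝ κ ∧
    (∀ j, ∫⁻ y, r j y ∂(discreteMeasure w x) ≤ c j) ∧
      ∫⁻ y, g y ∂(discreteMeasure w x) ≤ opt}
  have hcont : ∀ {f : X → ℝ≥0∞}, LowerSemicontinuous f →
      LowerSemicontinuous fun w : κ → ℝ => ∫⁻ y, f y ∂(discreteMeasure w x) := by
    intro f hf
    simp_rw [lintegral_discreteMeasure _ _ hf.measurable]
    refine lowerSemicontinuous_sum fun a _ => LowerSemicontinuous.ennreal_mul ?_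
      lowerSemicontinuous_const
    exact (ENNReal.continuous_ofReal.comp (continuous_apply a)).lowerSemicontinuous
  have hWr : IsClosed {w : κ → ℝ | ∀ j, ∫⁻ y, r j y ∂(discreteMeasure w x) ≤ c j} := by
    simp only [Set.ofPred_forall]
    exact isClosed_iInter fun j => (hcont (hr j)).isClosed_preimage (c j)
  have hWc : IsCompact W := (isCompact_stdSimplex ℝ κ).inter_right
    (hWr.inter ((hcont hg).isClosed_preimage opt))
  obtain ⟨w', hw'⟩ := hWc.extremePoints_nonempty ⟨w, hw, hqK, le_rfl⟩
  have hfeas : discreteMeasure w' x ∈ momentFeasible r c :=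
    ⟨isProbabilityMeasure_discreteMeasure hw'.1.1 x, hw'.1.2.1⟩
  refine ⟨discreteMeasure w' x, hfeas, ?_, fun π' hπ' => hw'.1.2.2.trans (hopt_le π' hπ')⟩
  by_contra! hlt
  obtain ⟨h, hh, h1, hne, hpert⟩ := exists_perturbation (fun j => (hr j).measurable) hc hfeas hlt
  have hprob := hfeas.1
  have hden : ∀ s : ℝ, (discreteMeasure w' x).withDensity
      (fun y => ENNReal.ofReal (1 + s * h y)) =
        discreteMeasure (fun a => w' a * (1 + s * h (x a))) x := fun s =>
    withDensity_discreteMeasure hw'.1.1.1 x ((hh.const_mul s).const_add 1)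
  have hsumg : ∫⁻ y, g y ∂(discreteMeasure (fun a => w' a * (1 + 1 * h (x a))) x) +
      ∫⁻ y, g y ∂(discreteMeasure (fun a => w' a * (1 + -1 * h (x a))) x) ≤ opt + opt := by
    rw [← hden, ← hden, ← lintegral_add_measure, withDensity_add_withDensity_sub hh h1,
      lintegral_smul_measure]
    simp only [ENNReal.smul_def, ENNReal.coe_ofNat, smul_eq_mul]
    rw [two_mul]
    exact add_le_add hw'.1.2.2 hw'.1.2.2
  have hmemW : ∀ s : ℝ, |s| ≤ 1 →
      ∫⁻ y, g y ∂(discreteMeasure (fun a => w' a * (1 + s * h (x a))) x) ≤ opt →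
      (fun a => w' a * (1 + s * h (x a))) ∈ W := by
    intro s hs hgs
    have hf := hpert s hs
    rw [hden] at hf
    have hnn : ∀ a, 0 ≤ w' a * (1 + s * h (x a)) := by
      intro a
      have : |s * h (x a)| ≤ 1 := by
        rw [abs_mul]; exact mul_le_one₀ hs (abs_nonneg _) (h1 _)
      exact mul_nonneg (hw'.1.1.1 a) (by linarith [(abs_le.1 this).1])
    refine ⟨⟨hnn, ?_⟩, hf.2, hgs⟩
    have := hf.1.measure_univ
    simp only [discreteMeasure, Measure.coe_finsetSum, Finset.sum_apply, Measure.smul_apply,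
      measure_univ, smul_eq_mul, mul_one] at this
    rwa [← ENNReal.ofReal_sum_of_nonneg (fun a _ => hnn a), ENNReal.ofReal_eq_one] at this
  -- Each perturbation costs at least `opt` and the two together at most `2 * opt`, so both are
  -- optimal and their weights lie in `W`.
  have hle1 := hopt_le _ (hden 1 ▸ hpert 1 (by simp))
  have hle2 := hopt_le _ (hden (-1) ▸ hpert (-1) (by simp))
  have hW1 := hmemW 1 (by simp)
    ((ENNReal.add_le_add_iff_right hopt_fin).1 ((add_le_add_right hle2 _).trans hsumg))
  have hW2 := hmemW (-1) (by simp)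
    ((ENNReal.add_le_add_iff_left hopt_fin).1 ((add_le_add_left hle1 _).trans hsumg))
  have heq := hw'.2 hW1 hW2 ⟨1 / 2, 1 / 2, by norm_num, by norm_num, by norm_num, by
    ext a
    simp only [Pi.add_apply, Pi.smul_apply, smul_eq_mul]
    ring⟩
  refine hne (ae_discreteMeasure_of_forall (measurableSet_eq_fun hh measurable_const)
    fun a ha => ?_)
  have := congrFun heq a
  simp only [one_mul, mul_eq_left₀ ha.ne', add_eq_left] at this
  exact this

end Optimum

/-! ### Laws of posterior beliefs and necessity of the constraints -/

namespace Persuasion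

theorem lintegral_beliefMeasure {Ω : Type*} [Fintype Ω] [MeasurableSpace Ω]
    [DiscreteMeasurableSpace Ω] (p : Belief Ω) (f : Ω → ℝ≥0∞) :
    ∫⁻ ω, f ω ∂(beliefMeasure p) = ∑ ω, ENNReal.ofReal (p.1 ω) * f ω :=
  lintegral_discreteMeasure p.1 id (Measurable.of_discrete)

theorem lintegral_compProd_beliefMeasure {Ω : Type*} [Fintype Ω] [MeasurableSpace Ω]
    [DiscreteMeasurableSpace Ω] {S : Type*} [MeasurableSpace S] (p : Belief Ω) (κ : Kernel Ω S)
    [IsMarkovKernel κ] {f : Ω × S → ℝ≥0∞} (hf : Measurable f) :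
    ∫⁻ q, f q ∂(beliefMeasure p ⊗ₘ κ) =
      ∑ ω, ENNReal.ofReal (p.1 ω) * ∫⁻ s, f (ω, s) ∂(κ ω) := by
  rw [Measure.lintegral_compProd hf, lintegral_beliefMeasure]

namespace InfoStructure

variable {Ω : Type u} [MeasurableSpace Ω] {N : Type v} [Fintype Ω] [DiscreteMeasurableSpace Ω]
  [Nonempty Ω]

theorem ofReal_belief (I : InfoStructure.{u, v, w} Ω N) (p : Belief Ω) (i : N) (s : I.S i)
    (ω : Ω) : ENNReal.ofReal ((I.belief p i s).1 ω) =
      posterior (I.receiverSignal i) (beliefMeasure p) s {ω} :=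
  ofReal_measureReal

theorem measurable_belief (I : InfoStructure.{u, v, w} Ω N) (p : Belief Ω) (i : N) :
    Measurable (I.belief p i) := by
  refine Measurable.subtype_mk (measurable_pi_iff.2 fun ω => ?_)
  exact (Kernel.measurable_coe _ (measurableSet_singleton ω)).ennreal_toReal

theorem measurable_beliefs (I : InfoStructure.{u, v, w} Ω N) (p : Belief Ω) :
    Measurable (I.beliefs p) :=
  measurable_pi_iff.2 fun i => (I.measurable_belief p i).comp (measurable_pi_apply i)

/-- The disintegration of the joint law of state and signal along the signal. -/
theorem lintegral_mul_belief (I : InfoStructure.{u, v, w} Ω N) (p : Belief Ω) (i : N) (ω : Ω)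
    {f : I.S i → ℝ≥0∞} (hf : Measurable f) :
    ∫⁻ s, f s * ENNReal.ofReal ((I.belief p i s).1 ω)
        ∂((I.receiverSignal i) ∘ₘ (beliefMeasure p)) =
      ENNReal.ofReal (p.1 ω) * ∫⁻ s, f s ∂(I.receiverSignal i ω) := by
  classical
  -- The joint law of signal and state is integrated against this function in two ways: through the
  -- posterior, and through the prior and the signal kernel.
  let F : I.S i × Ω → ℝ≥0∞ := fun q => f q.1 * ({ω} : Set Ω).indicator 1 q.2
  have hF : Measurable F := (hf.comp measurable_fst).mul
    ((measurable_one.indicator (measurableSet_singleton ω)).comp measurable_snd)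
  have h := congrArg (fun μ => ∫⁻ q, F q ∂μ)
    (compProd_posterior_eq_map_swap (κ := I.receiverSignal i) (μ := beliefMeasure p))
  beta_reduce at h
  rw [Measure.lintegral_compProd hF, lintegral_map hF measurable_swap,
    lintegral_compProd_beliefMeasure p _ (f := fun q => F q.swap) (hF.comp measurable_swap)] at h
  have hleft : ∀ s, ∫⁻ ω', F (s, ω') ∂(posterior (I.receiverSignal i) (beliefMeasure p) s) =
      f s * ENNReal.ofReal ((I.belief p i s).1 ω) := by
    intro s
    simp only [F]
    rw [lintegral_const_mul _ (measurable_one.indicator (measurableSet_singleton ω)),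
      lintegral_indicator_one (measurableSet_singleton ω), ofReal_belief]
  simp_rw [hleft] at h
  rw [h, Finset.sum_eq_single ω]
  · simp [F]
  · intro b _ hb
    simp [F, hb]
  · simp

theorem map_eval_beliefLaw (I : InfoStructure.{u, v, w} Ω N) (p : Belief Ω) (ω : Ω) (i : N) :
    (I.beliefLaw p ω).map (fun y => y i) = (I.receiverSignal i ω).map (I.belief p i) := by
  rw [beliefLaw, receiverSignal, Kernel.map_apply _ (measurable_pi_apply i),
    Measure.map_map (measurable_pi_apply i) (I.measurable_beliefs p),
    Measure.map_map (I.measurable_belief p i) (measurable_pi_apply i)]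
  rfl

instance (I : InfoStructure.{u, v, w} Ω N) (p : Belief Ω) (ω : Ω) :
    IsProbabilityMeasure (I.beliefLaw p ω) :=
  Measure.isProbabilityMeasure_map (I.measurable_beliefs p).aemeasurable

end InfoStructure

/-- In `ℝ≥0∞` division gives `a / 0 = ∞` for `a ≠ 0` and `0 / 0 = 0`, which is the convention
required of the integrand. -/
theorem measurable_ratio {Ω : Type*} [Fintype Ω] (ω₀ ω : Ω) :
    Measurable fun x : Belief Ω => ENNReal.ofReal (x.1 ω) / ENNReal.ofReal (x.1 ω₀) :=
  (((measurable_pi_apply ω).comp measurable_subtype_coe).ennreal_ofReal).div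
    (((measurable_pi_apply ω₀).comp measurable_subtype_coe).ennreal_ofReal)

namespace Problem

variable {Ω : Type u} [Fintype Ω] {N : Type v}

theorem ofReal_prior_ne_zero (B : Problem Ω N) (ω : Ω) : ENNReal.ofReal (B.prior.1 ω) ≠ 0 :=
  (ENNReal.ofReal_pos.2 (B.prior_pos ω)).ne'

theorem ratioIntegral_eq (ω₀ : Ω) (π : Measure (N → Belief Ω)) (i : N) (ω : Ω) :
    ratioIntegral ω₀ π i ω =
      ∫⁻ y, ENNReal.ofReal ((y i).1 ω) / ENNReal.ofReal ((y i).1 ω₀) ∂π :=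
  lintegral_map (measurable_ratio ω₀ ω) (measurable_pi_apply i)

section

variable [MeasurableSpace Ω] [DiscreteMeasurableSpace Ω] [Nonempty Ω]

/-- The law of the beliefs in state `ω₀` is feasible for every information structure. -/
theorem beliefLaw_mem_oneStateFeasible (B : Problem Ω N) (ω₀ : Ω)
    (I : InfoStructure.{u, v, w} Ω N) : I.beliefLaw B.prior ω₀ ∈ B.oneStateFeasible ω₀ := by
  refine ⟨inferInstance, fun i ω _ => ?_⟩
  rw [ratioIntegral, I.map_eval_beliefLaw,
    lintegral_map (measurable_ratio ω₀ ω) (I.measurable_belief _ i),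
    ENNReal.ofReal_div_of_pos (B.prior_pos ω₀),
    ENNReal.le_div_iff_mul_le (Or.inl (B.ofReal_prior_ne_zero ω₀)) (Or.inl ENNReal.ofReal_ne_top),
    mul_comm, ← I.lintegral_mul_belief B.prior i ω₀
      (f := fun s => ENNReal.ofReal ((I.belief B.prior i s).1 ω) /
        ENNReal.ofReal ((I.belief B.prior i s).1 ω₀)) ((measurable_ratio ω₀ ω).comp (I.measurable_belief B.prior i))]
  have h := I.lintegral_mul_belief B.prior i ω (f := fun _ => 1) measurable_const
  simp only [one_mul, lintegral_one, measure_univ, mul_one] at h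
  rw [← h]
  -- The pointwise inequality is strict only where `x(ω₀) = 0 < x(ω)`: signals that rule out `ω₀`
  -- but not `ω` create the slack.
  refine lintegral_mono fun s => ?_
  exact (mul_comm _ _).trans_le ENNReal.mul_div_le

end

end Problem

/-! ### Extended integrals and reduction to the state `ω₀` -/

section ExtIntegral

variable {X : Type*} [MeasurableSpace X]

/-- Turns maximising the integral of a function bounded above into minimising that of the
nonnegative cost `C - f`. If the negative part has infinite integral, both sides are `-∞`. -/
theorem extIntegral_eq_sub {π : Measure X} [IsProbabilityMeasure π] {f : X → ℝ}
    (hf : Measurable f) {C : ℝ} (hC : 0 ≤ C) (hfC : ∀ x, f x ≤ C) :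
    extIntegral π f = (C : EReal) - ((∫⁻ x, ENNReal.ofReal (C - f x) ∂π : ℝ≥0∞) : EReal) := by
  have hsum : ∫⁻ x, ENNReal.ofReal (C - f x) ∂π + ∫⁻ x, ENNReal.ofReal (f x) ∂π =
      ENNReal.ofReal C + ∫⁻ x, ENNReal.ofReal (-f x) ∂π := by
    rw [← lintegral_add_right _ hf.ennreal_ofReal]
    have hconst : ENNReal.ofReal C = ∫⁻ _, ENNReal.ofReal C ∂π := by simp
    rw [hconst, ← lintegral_add_left measurable_const]
    refine lintegral_congr fun x => ?_
    rcases le_total 0 (f x) with h | h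
    · rw [← ENNReal.ofReal_add (sub_nonneg.2 (hfC x)) h, sub_add_cancel,
        ENNReal.ofReal_of_nonpos (neg_nonpos.2 h), add_zero]
    · rw [ENNReal.ofReal_of_nonpos h, add_zero, ← ENNReal.ofReal_add hC (neg_nonneg.2 h),
        sub_eq_add_neg]
  have hA : ∫⁻ x, ENNReal.ofReal (f x) ∂π ≠ ∞ := by
    refine ne_top_of_le_ne_top (b := ENNReal.ofReal C) ENNReal.ofReal_ne_top ?_
    exact (lintegral_mono fun x => ENNReal.ofReal_le_ofReal (hfC x)).trans (by simp)
  rw [extIntegral]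
  generalize ∫⁻ x, ENNReal.ofReal (C - f x) ∂π = G at *
  generalize ∫⁻ x, ENNReal.ofReal (f x) ∂π = A at *
  generalize ∫⁻ x, ENNReal.ofReal (-f x) ∂π = D at *
  rcases eq_or_ne D ∞ with rfl | hD
  · have : G = ∞ := by
      simpa [hA] using hsum
    rw [this]
    lift A to ℝ≥0 using hA
    simp
  · have hG : G ≠ ∞ := by
      rintro rfl
      rw [top_add] at hsum
      exact ENNReal.add_ne_top.2 ⟨ENNReal.ofReal_ne_top, hD⟩ hsum.symm
    lift A to ℝ≥0 using hA
    lift D to ℝ≥0 using hD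
    lift G to ℝ≥0 using hG
    have h := congrArg ENNReal.toReal hsum
    rw [ENNReal.toReal_add (by simp) (by simp), ENNReal.toReal_add (by simp) (by simp),
      ENNReal.toReal_ofReal hC] at h
    simp only [ENNReal.coe_toReal] at h
    simp only [EReal.coe_nnreal_eq_coe_real]
    norm_cast
    linarith

theorem coe_mul_extIntegral {π : Measure X} {f : X → ℝ}
    (hA : ∫⁻ x, ENNReal.ofReal (f x) ∂π ≠ ∞) {a : ℝ} (ha : 0 < a) :
    (a : EReal) * extIntegral π f =
      ((ENNReal.ofReal a * ∫⁻ x, ENNReal.ofReal (f x) ∂π : ℝ≥0∞) : EReal) -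
        ((ENNReal.ofReal a * ∫⁻ x, ENNReal.ofReal (-f x) ∂π : ℝ≥0∞) : EReal) := by
  rw [extIntegral]
  generalize ∫⁻ x, ENNReal.ofReal (f x) ∂π = A at *
  generalize ∫⁻ x, ENNReal.ofReal (-f x) ∂π = D at *
  lift A to ℝ≥0 using hA
  rcases eq_or_ne D ∞ with rfl | hD
  · rw [ENNReal.mul_top (ENNReal.ofReal_pos.2 ha).ne']
    simp only [EReal.coe_ennreal_top, EReal.sub_top]
    exact EReal.coe_mul_bot_of_pos ha
  · lift D to ℝ≥0 using hD
    simp only [EReal.coe_ennreal_mul, EReal.coe_ennreal_ofReal, max_eq_left ha.le,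
      EReal.coe_nnreal_eq_coe_real]
    norm_cast
    ring

end ExtIntegral

namespace Problem

variable {Ω : Type u} [Fintype Ω] {N : Type v}

theorem measurable_utility [Countable N] (B : Problem Ω N) (ω : Ω) : Measurable (B.utility ω) :=
  (B.usc ω).measurable

theorem exists_utility_le (B : Problem Ω N) (ω : Ω) :
    ∃ C : ℝ, 0 ≤ C ∧ ∀ x, B.utility ω x ≤ C := by
  obtain ⟨C, hC⟩ := ((B.usc ω).upperSemicontinuousOn Set.univ).bddAbove_of_isCompact isCompact_univ
  exact ⟨max C 0, le_max_right _ _,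
    fun x => (hC ⟨x, Set.mem_univ _, rfl⟩).trans (le_max_left _ _)⟩

variable [Countable N] [MeasurableSpace Ω] [DiscreteMeasurableSpace Ω] [Nonempty Ω]

/-- In a one-state problem the expected utility depends only on the law of the beliefs in that
state. -/
theorem IsOneState.expectedUtility_eq {B : Problem Ω N} {ω₀ : Ω} (hB : B.IsOneState ω₀)
    (I : InfoStructure.{u, v, w} Ω N) :
    B.expectedUtility I =
      (B.prior.1 ω₀ : EReal) * extIntegral (I.beliefLaw B.prior ω₀) (B.utility ω₀) := by
  obtain ⟨C, -, hC⟩ := B.exists_utility_le ω₀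
  have hv := B.measurable_utility ω₀
  have hm : Measurable fun q : Ω × (∀ i, I.S i) =>
      B.utility q.1 (I.beliefs B.prior q.2) :=
    measurable_from_prod_countable_right fun ω =>
      (B.measurable_utility ω).comp (I.measurable_beliefs B.prior)
  -- Covers the positive and the negative part at once; `φ 0 = 0` removes the states with zero
  -- utility.
  have key : ∀ φ : ℝ → ℝ≥0∞, Measurable φ → φ 0 = 0 →
      ∫⁻ q, φ (B.utility q.1 (I.beliefs B.prior q.2)) ∂(beliefMeasure B.prior ⊗ₘ I.signal) =
        ENNReal.ofReal (B.prior.1 ω₀) *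
          ∫⁻ x, φ (B.utility ω₀ x) ∂(I.beliefLaw B.prior ω₀) := by
    intro φ hφ hφ0
    rw [lintegral_compProd_beliefMeasure _ _
        (f := fun q => φ (B.utility q.1 (I.beliefs B.prior q.2))) (hφ.comp hm),
      InfoStructure.beliefLaw,
      lintegral_map (f := fun x => φ (B.utility ω₀ x)) (hφ.comp hv)
        (I.measurable_beliefs B.prior)]
    refine Finset.sum_eq_single ω₀ (fun ω _ hω => ?_) (by simp)
    simp [hB ω hω, hφ0]
  rw [coe_mul_extIntegral ?_ (B.prior_pos ω₀), expectedUtility, extIntegral,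
    key (fun t => ENNReal.ofReal t) ENNReal.measurable_ofReal (by simp),
    key (fun t => ENNReal.ofReal (-t)) (ENNReal.measurable_ofReal.comp measurable_neg) (by simp)]
  refine ne_top_of_le_ne_top (b := ENNReal.ofReal C) ENNReal.ofReal_ne_top ?_
  exact (lintegral_mono fun x => ENNReal.ofReal_le_ofReal (hC x)).trans (by simp)

end Problem

end Persuasion

/-! ### Information structures that recommend beliefs -/

theorem measurable_of_measurable_compl_finset {X Y : Type*} [MeasurableSpace X]
    [MeasurableSingletonClass X] [MeasurableSpace Y] [Countable Y] (T : Finset X)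
    (y₀ : Y) {f : X → Y} (hf : ∀ x, x ∉ T → f x = y₀) : Measurable f := by
  refine measurable_to_countable' fun y => ?_
  by_cases hy : y = y₀
  · have : (f ⁻¹' {y})ᶜ ⊆ T := by
      intro x hx
      by_contra hxT
      exact hx (by simp [hf x hxT, hy])
    exact (T.finite_toSet.subset this).measurableSet.of_compl
  · have : f ⁻¹' {y} ⊆ T := by
      intro x hx
      by_contra hxT
      exact hy (by rw [← hf x hxT]; exact hx.symm)
    exact (T.finite_toSet.subset this).measurableSet

namespace Persuasion

namespace InfoStructure

variable {Ω : Type u} [MeasurableSpace Ω] {N : Type v} [Fintype Ω] [DiscreteMeasurableSpace Ω]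
  [Nonempty Ω]

/-- On a signal of positive probability the belief is given by Bayes' formula. -/
theorem belief_eq_of_bayes (I : InfoStructure.{u, v, w} Ω N) {p : Belief Ω} (i : N) {s : I.S i}
    (hs : MeasurableSet {s}) {x : Belief Ω} {K : ℝ≥0∞}
    (hK : ∀ ω, ENNReal.ofReal (p.1 ω) * I.receiverSignal i ω {s} =
      ENNReal.ofReal (x.1 ω) * K)
    {ω₀ : Ω} (hp : 0 < p.1 ω₀) (h₀ : I.receiverSignal i ω₀ {s} ≠ 0) :
    I.belief p i s = x := by
  have hb : ∀ ω, ENNReal.ofReal ((I.belief p i s).1 ω) *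
      ((I.receiverSignal i) ∘ₘ (beliefMeasure p)) {s} = ENNReal.ofReal (x.1 ω) * K := by
    intro ω
    have h := I.lintegral_mul_belief p i ω (measurable_one.indicator hs)
    have : ∀ t, ({s} : Set (I.S i)).indicator 1 t * ENNReal.ofReal ((I.belief p i t).1 ω) =
        ({s} : Set (I.S i)).indicator (fun _ => ENNReal.ofReal ((I.belief p i s).1 ω)) t := by
      intro t
      by_cases ht : t = s
      · subst ht; simp
      · simp [ht]
    simp_rw [this] at h
    rwa [lintegral_indicator_const hs, lintegral_indicator_one hs, hK] at h
  have hsum : ∀ y : Belief Ω, ∑ ω, ENNReal.ofReal (y.1 ω) = 1 := fun y => by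
    rw [← ENNReal.ofReal_sum_of_nonneg fun ω _ => y.2.1 ω, y.2.2, ENNReal.ofReal_one]
  -- Both beliefs sum to one, so summing over the states identifies `K` with the total probability
  -- of `s`, which can then be cancelled.
  have hQK : ((I.receiverSignal i) ∘ₘ (beliefMeasure p)) {s} = K := by
    have := Finset.sum_congr (rfl : Finset.univ = Finset.univ) fun ω _ => hb ω
    rwa [← Finset.sum_mul, ← Finset.sum_mul, hsum, hsum, one_mul, one_mul] at this
  have hK0 : K ≠ 0 := by
    rintro rfl
    have := hK ω₀
    simp only [mul_zero, mul_eq_zero, ENNReal.ofReal_eq_zero, not_le.2 hp, false_or] at this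
    exact h₀ this
  have hKt : K ≠ ∞ := hQK ▸ measure_ne_top _ _
  refine Subtype.ext (funext fun ω => ?_)
  have := hb ω
  rw [hQK, ENNReal.mul_left_inj hK0 hKt,
    ENNReal.ofReal_eq_ofReal_iff ((I.belief p i s).2.1 ω) (x.2.1 ω)] at this
  exact this

/-- Laws of finitely supported profiles of beliefs that satisfy Bayes' formula are the belief laws
of an information structure that recommends the beliefs to the receivers. -/
theorem exists_beliefLaw_eq [Countable N] {p : Belief Ω} (T : N → Finset (Belief Ω))
    (hT : ∀ i, (T i).Nonempty)
    (ρ : Ω → Measure (N → Belief Ω)) [∀ ω, IsProbabilityMeasure (ρ ω)]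
    (hρT : ∀ ω i, ∀ᵐ y ∂(ρ ω), y i ∈ T i)
    (hbayes : ∀ i, ∀ x ∈ T i, ∃ K : ℝ≥0∞, ∀ ω,
      ENNReal.ofReal (p.1 ω) * (ρ ω).map (fun y => y i) {x} = ENNReal.ofReal (x.1 ω) * K) :
    ∃ I : InfoStructure.{u, v, w} Ω N, I.UsesAtMost (fun i => (T i).card) ∧
      ∀ ω, 0 < p.1 ω → I.beliefLaw p ω = ρ ω := by
  classical
  let S : N → Type w := fun i => ULift.{w} (Fin (T i).card)
  let mS : ∀ i, MeasurableSpace (S i) := fun _ => ⊤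
  have hdS : ∀ i, DiscreteMeasurableSpace (S i) := fun i => ⟨fun _ => trivial⟩
  -- The default signal for beliefs outside `T i` is immaterial, as these have probability zero in
  -- every state.
  let enc : ∀ i, Belief Ω → S i := fun i x =>
    if h : x ∈ T i then ⟨(T i).equivFin ⟨x, h⟩⟩ else ⟨⟨0, (hT i).card_pos⟩⟩
  let dec : ∀ i, S i → Belief Ω := fun i s => ((T i).equivFin.symm s.down).1
  have hencdec : ∀ i s, enc i (dec i s) = s := by
    intro i s
    simp only [enc, dec, Subtype.coe_eta, Finset.coe_mem, dif_pos, Equiv.apply_symm_apply]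
    rfl
  have hdecenc : ∀ i, ∀ x ∈ T i, dec i (enc i x) = x := by
    intro i x hx
    simp [enc, dec, hx]
  have henc : ∀ i, Measurable (enc i) := fun i =>
    measurable_of_measurable_compl_finset (T i) _ fun x hx => dif_neg hx
  have hE : Measurable fun (y : N → Belief Ω) i => enc i (y i) :=
    measurable_pi_iff.2 fun i => (henc i).comp (measurable_pi_apply i)
  let κ : Kernel Ω (∀ i, S i) :=
    ⟨fun ω => (ρ ω).map fun y i => enc i (y i), Measurable.of_discrete⟩
  let I : InfoStructure.{u, v, w} Ω N :=
    { S := S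
      mS := mS
      signal := κ
      isMarkov := ⟨fun ω => Measure.isProbabilityMeasure_map hE.aemeasurable⟩ }
  refine ⟨I, fun i => ⟨hdS i, inferInstanceAs (Finite (ULift (Fin (T i).card))), ?_⟩, ?_⟩
  · exact (Nat.card_ulift _).trans_le (Nat.card_fin _).le
  have hsignal : ∀ i ω s, I.receiverSignal i ω {s} =
      (ρ ω).map (fun y => y i) {dec i s} := by
    intro i ω s
    have hκ : I.receiverSignal i ω = (ρ ω).map fun y => enc i (y i) := by
      rw [receiverSignal, Kernel.map_apply _ (measurable_pi_apply i)]
      exact Measure.map_map (measurable_pi_apply i) hE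
    have hm : Measurable fun y : N → Belief Ω => enc i (y i) :=
      (henc i).comp (measurable_pi_apply i)
    rw [hκ, Measure.map_apply hm (@MeasurableSet.of_discrete _ _ (hdS i) _),
      Measure.map_apply (measurable_pi_apply i) (measurableSet_singleton _)]
    refine measure_congr ?_
    filter_upwards [hρT ω i] with y hy
    refine propext ⟨fun h => ?_, fun h => ?_⟩
    · change enc i (y i) = s at h
      change y i = dec i s
      rw [← h, hdecenc i _ hy]
    · change y i = dec i s at h
      change enc i (y i) = s
      rw [h, hencdec]
  intro ω hω
  -- Posteriors are pinned down only at signals of positive probability, and almost every profile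
  -- consists of such signals because each `T i` is finite.
  have hnull : ∀ i, ∀ᵐ y ∂(ρ ω), (ρ ω).map (fun y => y i) {y i} ≠ 0 := by
    intro i
    have hsub : {y : N → Belief Ω | ¬ (ρ ω).map (fun y => y i) {y i} ≠ 0} ⊆
        (⋃ x ∈ (T i).filter (fun x => (ρ ω).map (fun y => y i) {x} = 0),
          (fun y : N → Belief Ω => y i) ⁻¹' {x}) ∪ {y | ¬ y i ∈ T i} := by
      intro y hy
      by_cases hyT : y i ∈ T i
      · refine Or.inl (Set.mem_iUnion₂.2 ⟨y i, Finset.mem_filter.2 ⟨hyT, not_not.1 hy⟩, rfl⟩)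
      · exact Or.inr hyT
    refine measure_mono_null hsub (measure_union_null ?_ (hρT ω i))
    refine (measure_biUnion_null_iff (Finset.countable_toSet _)).2 fun x hx => ?_
    rw [← Measure.map_apply (measurable_pi_apply i) (measurableSet_singleton _)]
    exact (Finset.mem_filter.1 hx).2
  have hid : ∀ᵐ y ∂(ρ ω), I.beliefs p (fun i => enc i (y i)) = y := by
    filter_upwards [ae_all_iff.2 (hρT ω), ae_all_iff.2 hnull] with y hyT hy0
    funext i
    obtain ⟨K, hK⟩ := hbayes i (y i) (hyT i)
    have hdy : dec i (enc i (y i)) = y i := hdecenc i _ (hyT i)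
    refine I.belief_eq_of_bayes i (@MeasurableSet.of_discrete _ _ (hdS i) _) (K := K)
      (fun ω' => ?_) hω ?_
    · rw [hsignal, hdy, hK]
    · rw [hsignal, hdy]
      exact hy0 i
  calc I.beliefLaw p ω = (ρ ω).map (fun y => I.beliefs p fun i => enc i (y i)) :=
        Measure.map_map (I.measurable_beliefs p) hE
    _ = (ρ ω).map id := Measure.map_congr hid
    _ = ρ ω := Measure.map_id

end InfoStructure

end Persuasion

/-! ### Implementation of feasible laws with few signals -/

namespace Persuasion

namespace Problem

variable {Ω : Type u} [Fintype Ω] {N : Type v}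

/-- The image of a finite support is closed and carries all the mass of the marginal. -/
theorem support_map_eval_subset [Countable N] {π : Measure (N → Belief Ω)}
    (hfin : π.support.Finite) (i : N) :
    (π.map fun y => y i).support ⊆ (fun y => y i) '' π.support := by
  refine Measure.support_subset_of_isClosed (hfin.image _).isClosed ?_
  rw [mem_ae_iff, Measure.map_apply (measurable_pi_apply i) (hfin.image _).measurableSet.compl]
  refine measure_mono_null (t := π.supportᶜ) (fun y hy hys => hy ⟨y, hys, rfl⟩) ?_
  exact Measure.measure_compl_support

/-- The inactive constraints are the ones that require an additional, state-revealing signal. -/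
theorem activeCount_eq (B : Problem Ω N) (ω₀ : Ω) (π : Measure (N → Belief Ω)) (i : N) :
    B.activeCount ω₀ π i + {ω | ω ≠ ω₀ ∧ ¬ ratioIntegral ω₀ π i ω =
      ENNReal.ofReal (B.prior.1 ω / B.prior.1 ω₀)}.ncard = Fintype.card Ω - 1 := by
  classical
  rw [activeCount, ← Set.ncard_union_eq ?_ (Set.toFinite _) (Set.toFinite _)]
  · have : {ω | ω ≠ ω₀ ∧ ratioIntegral ω₀ π i ω =
        ENNReal.ofReal (B.prior.1 ω / B.prior.1 ω₀)} ∪ {ω | ω ≠ ω₀ ∧ ¬ ratioIntegral ω₀ π i ω =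
          ENNReal.ofReal (B.prior.1 ω / B.prior.1 ω₀)} = {ω₀}ᶜ := by
      ext ω
      simp only [Set.mem_union, Set.mem_ofPred_eq, Set.mem_compl_iff, Set.mem_singleton_iff]
      tauto
    rw [this, Set.ncard_compl, Set.ncard_singleton, Nat.card_eq_fintype_card]
  · exact Set.disjoint_left.2 fun ω h h' => h'.2 h.2

theorem activeCount_le (B : Problem Ω N) (ω₀ : Ω) (π : Measure (N → Belief Ω)) (i : N) :
    B.activeCount ω₀ π i ≤ Fintype.card Ω - 1 :=
  (Nat.le_add_right _ _).trans_eq (B.activeCount_eq ω₀ π i)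

section Marginal

/-- The law of the recommended belief of a receiver in state `ω ≠ ω₀`, when the law in state `ω₀`
is `τ`: the remaining mass is put on the belief that is certain of `ω`. -/
noncomputable def stateMarginal (p : Belief Ω) (ω₀ ω : Ω) (δ : Belief Ω)
    (τ : Measure (Belief Ω)) : Measure (Belief Ω) :=
  (ENNReal.ofReal (p.1 ω₀) / ENNReal.ofReal (p.1 ω)) • τ.withDensity
      (fun x => ENNReal.ofReal (x.1 ω) / ENNReal.ofReal (x.1 ω₀)) +
    (1 - ENNReal.ofReal (p.1 ω₀) / ENNReal.ofReal (p.1 ω) *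
      ∫⁻ x, ENNReal.ofReal (x.1 ω) / ENNReal.ofReal (x.1 ω₀) ∂τ) • Measure.dirac δ

variable {p : Belief Ω} {ω₀ ω : Ω} {δ : Belief Ω} {τ : Measure (Belief Ω)}

/-- Feasibility bounds the mass of the absolutely continuous part by one, so the truncated
subtraction in the definition is a true one. -/
theorem isProbabilityMeasure_stateMarginal (hp₀ : 0 < p.1 ω₀) (hp : 0 < p.1 ω)
    (h : ∫⁻ x, ENNReal.ofReal (x.1 ω) / ENNReal.ofReal (x.1 ω₀) ∂τ ≤
      ENNReal.ofReal (p.1 ω / p.1 ω₀)) :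
    IsProbabilityMeasure (stateMarginal p ω₀ ω δ τ) := by
  constructor
  simp only [stateMarginal, Measure.add_apply, Measure.smul_apply, smul_eq_mul, measure_univ,
    mul_one, withDensity_apply _ MeasurableSet.univ, Measure.restrict_univ]
  refine add_tsub_cancel_of_le ?_
  calc _ ≤ ENNReal.ofReal (p.1 ω₀) / ENNReal.ofReal (p.1 ω) *
        ENNReal.ofReal (p.1 ω / p.1 ω₀) := by gcongr
    _ = 1 := by
      rw [← ENNReal.ofReal_div_of_pos hp, ← ENNReal.ofReal_mul (div_pos hp₀ hp).le,
        div_mul_div_cancel₀ hp.ne', div_self hp₀.ne', ENNReal.ofReal_one]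

/-- An active constraint leaves no mass for `δ`, which then need not belong to `T`. This is how each
active constraint saves a signal. -/
theorem ae_mem_stateMarginal (hp₀ : 0 < p.1 ω₀) (hp : 0 < p.1 ω) {T : Finset (Belief Ω)}
    (hτ : ∀ᵐ x ∂τ, x ∈ T)
    (hδ : ∫⁻ x, ENNReal.ofReal (x.1 ω) / ENNReal.ofReal (x.1 ω₀) ∂τ ≠
      ENNReal.ofReal (p.1 ω / p.1 ω₀) → δ ∈ T) :
    ∀ᵐ x ∂(stateMarginal p ω₀ ω δ τ), x ∈ T := by
  rw [stateMarginal, ae_add_measure_iff]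
  refine ⟨Measure.ae_smul_measure ((withDensity_absolutelyContinuous _ _).ae_le hτ) _, ?_⟩
  by_cases h : ∫⁻ x, ENNReal.ofReal (x.1 ω) / ENNReal.ofReal (x.1 ω₀) ∂τ =
      ENNReal.ofReal (p.1 ω / p.1 ω₀)
  · rw [h, ← ENNReal.ofReal_div_of_pos hp, ← ENNReal.ofReal_mul (div_pos hp₀ hp).le,
      div_mul_div_cancel₀ hp.ne', div_self hp₀.ne', ENNReal.ofReal_one, tsub_self, zero_smul]
    simp
  · exact Measure.ae_smul_measure
      ((ae_dirac_iff T.measurableSet).2 (hδ h)) _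

theorem mul_stateMarginal_singleton (hp : 0 < p.1 ω) (x : Belief Ω) :
    ENNReal.ofReal (p.1 ω) * stateMarginal p ω₀ ω δ τ {x} =
      ENNReal.ofReal (p.1 ω₀) * (ENNReal.ofReal (x.1 ω) / ENNReal.ofReal (x.1 ω₀) * τ {x}) +
        ENNReal.ofReal (p.1 ω) * ((1 - ENNReal.ofReal (p.1 ω₀) / ENNReal.ofReal (p.1 ω) *
          ∫⁻ x, ENNReal.ofReal (x.1 ω) / ENNReal.ofReal (x.1 ω₀) ∂τ) *
            ({x} : Set (Belief Ω)).indicator 1 δ) := by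
  simp only [stateMarginal, Measure.add_apply, Measure.smul_apply, smul_eq_mul,
    Measure.dirac_apply' _ (measurableSet_singleton x),
    withDensity_apply _ (measurableSet_singleton x), lintegral_singleton' (measurable_ratio ω₀ ω)]
  rw [mul_add, ← mul_assoc, ENNReal.mul_div_cancel (ENNReal.ofReal_pos.2 hp).ne'
    ENNReal.ofReal_ne_top]

end Marginal

variable [Fintype N]

/-- Feasible laws with finite support are implemented by information structures with few
signals. -/
theorem exists_infoStructure [MeasurableSpace Ω] [DiscreteMeasurableSpace Ω] [Nonempty Ω]
    (B : Problem Ω N) (ω₀ : Ω) {π : Measure (N → Belief Ω)} (hπ : π ∈ B.oneStateFeasible ω₀) (hfin : π.support.Finite) :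
    ∃ I : InfoStructure.{u, v, w} Ω N,
      I.UsesAtMost (fun i => (π.map (fun y => y i)).support.ncard +
        (Fintype.card Ω - 1 - B.activeCount ω₀ π i)) ∧
      I.beliefLaw B.prior ω₀ = π := by
  classical
  have := hπ.1
  let τ : N → Measure (Belief Ω) := fun i => π.map fun y => y i
  have hτp : ∀ i, IsProbabilityMeasure (τ i) := fun i =>
    Measure.isProbabilityMeasure_map (measurable_pi_apply i).aemeasurable
  have hτfin : ∀ i, (τ i).support.Finite := fun i =>
    (hfin.image _).subset (support_map_eval_subset hfin i)
  let δ : Ω → Belief Ω := fun ω => ⟨Pi.single ω 1, single_mem_stdSimplex ℝ ω⟩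
  let J : N → Finset Ω := fun i => Finset.univ.filter fun ω => ω ≠ ω₀ ∧
    ¬ ratioIntegral ω₀ π i ω = ENNReal.ofReal (B.prior.1 ω / B.prior.1 ω₀)
  let T : N → Finset (Belief Ω) := fun i => (hτfin i).toFinset ∪ (J i).image δ
  have hsuppT : ∀ i, ∀ᵐ x ∂(τ i), x ∈ T i := by
    intro i
    filter_upwards [(τ i).support_mem_ae] with x hx
    exact Finset.mem_union_left _ ((hτfin i).mem_toFinset.2 hx)
  have hT : ∀ i, (T i).Nonempty := by
    intro i
    obtain ⟨x, hx⟩ := Measure.nonempty_support (IsProbabilityMeasure.ne_zero (τ i))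
    exact ⟨x, Finset.mem_union_left _ ((hτfin i).mem_toFinset.2 hx)⟩
  have hm : ∀ i ω, ω ≠ ω₀ →
      IsProbabilityMeasure (stateMarginal B.prior ω₀ ω (δ ω) (τ i)) := fun i ω hω =>
    isProbabilityMeasure_stateMarginal (B.prior_pos ω₀) (B.prior_pos ω) (hπ.2 i ω hω)
  -- Bayes' formula involves only marginals, so outside `ω₀` any coupling will do; the product is
  -- taken.
  let ρ : Ω → Measure (N → Belief Ω) := fun ω =>
    if ω = ω₀ then π else Measure.pi fun i => stateMarginal B.prior ω₀ ω (δ ω) (τ i)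
  have hρ₀ : ρ ω₀ = π := if_pos rfl
  have hρp : ∀ ω, IsProbabilityMeasure (ρ ω) := by
    intro ω
    by_cases hω : ω = ω₀
    · rw [hω, hρ₀]; infer_instance
    · have := fun i => hm i ω hω
      simp only [ρ, if_neg hω]
      infer_instance
  have hρm : ∀ i ω, ω ≠ ω₀ →
      (ρ ω).map (fun y => y i) = stateMarginal B.prior ω₀ ω (δ ω) (τ i) := by
    intro i ω hω
    have := fun i => hm i ω hω
    simp only [ρ, if_neg hω]
    exact (measurePreserving_eval (fun i => stateMarginal B.prior ω₀ ω (δ ω) (τ i)) i).map_eq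
  have hρT : ∀ ω i, ∀ᵐ y ∂(ρ ω), y i ∈ T i := by
    intro ω i
    refine ae_of_ae_map (f := fun y : N → Belief Ω => y i) (p := fun x => x ∈ T i)
      (measurable_pi_apply i).aemeasurable ?_
    by_cases hω : ω = ω₀
    · rw [hω, hρ₀]; exact hsuppT i
    · rw [hρm i ω hω]
      refine ae_mem_stateMarginal (B.prior_pos ω₀) (B.prior_pos ω) (hsuppT i) fun h => ?_
      exact Finset.mem_union_right _ (Finset.mem_image_of_mem _
        (Finset.mem_filter.2 ⟨Finset.mem_univ _, hω, h⟩))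
  -- An atom that excludes `ω₀` would make some ratio integral infinite.
  have hpos : ∀ i x, τ i {x} ≠ 0 → 0 < x.1 ω₀ := by
    intro i x hx
    refine (x.2.1 ω₀).lt_of_ne fun h0 => ?_
    obtain ⟨ω, hω⟩ : ∃ ω, x.1 ω ≠ 0 := by
      by_contra! hall
      simpa [hall] using x.2.2
    have hne : ω ≠ ω₀ := by rintro rfl; exact hω h0.symm
    have hle : ENNReal.ofReal (x.1 ω) / ENNReal.ofReal (x.1 ω₀) * τ i {x} ≤
        ratioIntegral ω₀ π i ω := by
      rw [← lintegral_singleton' (measurable_ratio ω₀ ω)]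
      exact setLIntegral_le_lintegral _ _
    rw [← h0, ENNReal.ofReal_zero, ENNReal.div_zero
      (ENNReal.ofReal_pos.2 ((x.2.1 ω).lt_of_ne' hω)).ne', ENNReal.top_mul hx] at hle
    exact ENNReal.ofReal_ne_top (top_le_iff.1 (hle.trans (hπ.2 i ω hne)))
  have hbayes : ∀ i, ∀ x ∈ T i, ∃ K : ℝ≥0∞, ∀ ω,
      ENNReal.ofReal (B.prior.1 ω) * (ρ ω).map (fun y => y i) {x} =
        ENNReal.ofReal (x.1 ω) * K := by
    intro i x _
    -- A belief without mass in state `ω₀` is either a revealing one, sent only in the state `ω₁`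
    -- that it reveals, or never sent. A belief with mass there has `x(ω₀) > 0`, so it differs from
    -- every revealing belief, and `K = p(ω₀) τ{x} / x(ω₀)` works in all states.
    by_cases hx : τ i {x} = 0
    · by_cases hxδ : ∃ ω₁, ω₁ ≠ ω₀ ∧ δ ω₁ = x
      · obtain ⟨ω₁, h1, rfl⟩ := hxδ
        refine ⟨ENNReal.ofReal (B.prior.1 ω₁) * (ρ ω₁).map (fun y => y i) {δ ω₁}, fun ω => ?_⟩
        by_cases hω1 : ω = ω₁
        · simp [hω1, δ]
        · have : (δ ω₁).1 ω = 0 := by simp [δ, hω1]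
          rw [this, ENNReal.ofReal_zero, zero_mul]
          by_cases hω : ω = ω₀
          · rw [hω, hρ₀]
            exact mul_eq_zero_of_right _ hx
          · rw [hρm i ω hω, mul_stateMarginal_singleton (B.prior_pos ω), hx]
            have : δ ω ≠ δ ω₁ := by
              intro h
              have := congrArg (fun z : Belief Ω => z.1 ω) h
              simp [δ, hω1] at this
            simp [this]
      · push Not at hxδ
        refine ⟨0, fun ω => ?_⟩
        rw [mul_zero]
        by_cases hω : ω = ω₀
        · rw [hω, hρ₀]
          exact mul_eq_zero_of_right _ hx
        · rw [hρm i ω hω, mul_stateMarginal_singleton (B.prior_pos ω), hx]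
          simp [hxδ ω hω]
    · have hx0 := hpos i x hx
      refine ⟨ENNReal.ofReal (B.prior.1 ω₀) / ENNReal.ofReal (x.1 ω₀) * τ i {x}, fun ω => ?_⟩
      by_cases hω : ω = ω₀
      · rw [hω, hρ₀, ← mul_assoc, ENNReal.mul_div_cancel (ENNReal.ofReal_pos.2 hx0).ne'
          ENNReal.ofReal_ne_top]
      · rw [hρm i ω hω, mul_stateMarginal_singleton (B.prior_pos ω)]
        have : δ ω ≠ x := by
          rintro rfl
          simp [δ, Ne.symm hω] at hx0
        simp only [Set.indicator_of_notMem (by simpa using this : δ ω ∉ ({x} : Set (Belief Ω))),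
          mul_zero, add_zero, div_eq_mul_inv]
        ring
  obtain ⟨I, hI, hlaw⟩ := InfoStructure.exists_beliefLaw_eq.{u, v, w} T hT ρ hρT hbayes
  refine ⟨I, fun i => ⟨(hI i).1, (hI i).2.1, (hI i).2.2.trans ?_⟩,
    (hlaw ω₀ (B.prior_pos ω₀)).trans hρ₀⟩
  refine (Finset.card_union_le _ _).trans (add_le_add ?_ (Finset.card_image_le.trans ?_))
  · rw [Set.ncard_eq_toFinset_card _ (hτfin i)]
  · have h := B.activeCount_eq ω₀ π i
    rw [Set.ncard_eq_toFinset_card'] at h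
    have : J i = {ω | ω ≠ ω₀ ∧ ¬ ratioIntegral ω₀ π i ω =
        ENNReal.ofReal (B.prior.1 ω / B.prior.1 ω₀)}.toFinset := by
      ext; simp [J]
    rw [this]
    omega

/-- The marginal has at most `n(π) + 1` atoms. The `n_i` in `n(π)` cancels against the signals saved
by receiver `i`, and each other receiver contributes at most `|Ω| - 1`. -/
theorem signal_bound (B : Problem Ω N) (ω₀ : Ω) {π : Measure (N → Belief Ω)}
    (hsupp : π.support.encard ≤ ((∑ i, B.activeCount ω₀ π i + 1 : ℕ) : ℕ∞)) (i : N) :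
    (π.map (fun y => y i)).support.ncard + (Fintype.card Ω - 1 - B.activeCount ω₀ π i) ≤
      Fintype.card N * (Fintype.card Ω - 1) + 1 := by
  classical
  have hfin : π.support.Finite := Set.finite_of_encard_le_coe hsupp
  have h1 : (π.map (fun y => y i)).support.ncard ≤ ∑ j, B.activeCount ω₀ π j + 1 := by
    refine (Set.ncard_le_ncard (support_map_eval_subset hfin i) (hfin.image _)).trans
      ((Set.ncard_image_le hfin).trans ?_)
    rw [← hfin.cast_ncard_eq] at hsupp
    exact_mod_cast hsupp
  have h2 : ∑ j ∈ Finset.univ.erase i, B.activeCount ω₀ π j ≤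
      (Fintype.card N - 1) * (Fintype.card Ω - 1) := by
    refine (Finset.sum_le_card_nsmul _ _ _ fun j _ => B.activeCount_le ω₀ π j).trans_eq ?_
    rw [Finset.card_erase_of_mem (Finset.mem_univ i), Finset.card_univ, smul_eq_mul]
  have h3 := Finset.add_sum_erase Finset.univ (B.activeCount ω₀ π) (Finset.mem_univ i)
  have h4 := B.activeCount_le ω₀ π i
  have h5 : (Fintype.card N - 1) * (Fintype.card Ω - 1) + (Fintype.card Ω - 1) =
      Fintype.card N * (Fintype.card Ω - 1) := by
    rw [← Nat.succ_mul, Nat.succ_eq_add_one, Nat.sub_add_cancel (Fintype.card_pos_iff.2 ⟨i⟩)]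
  omega

end Problem

end Persuasion

/-! ### The persuasion problem as a moment problem -/

namespace Persuasion

namespace Problem

variable {Ω : Type u} [Fintype Ω] {N : Type v} [Fintype N]

/-- The integrands of the feasibility constraints. -/
noncomputable def ratio (ω₀ : Ω) (j : N × {ω : Ω // ω ≠ ω₀}) (y : N → Belief Ω) : ℝ≥0∞ :=
  ENNReal.ofReal ((y j.1).1 j.2) / ENNReal.ofReal ((y j.1).1 ω₀)

/-- The bounds of the feasibility constraints. -/
noncomputable def ratioBound (B : Problem Ω N) (ω₀ : Ω) (j : N × {ω : Ω // ω ≠ ω₀}) : ℝ≥0∞ :=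
  ENNReal.ofReal (B.prior.1 j.2 / B.prior.1 ω₀)

-- The numerator and the inverse of the denominator are continuous into `[0, ∞]`; semicontinuity of
-- their product survives at `0 * ∞`, where continuity fails.
omit [Fintype N] in
theorem lowerSemicontinuous_ratio (ω₀ : Ω) (j : N × {ω : Ω // ω ≠ ω₀}) :
    LowerSemicontinuous (ratio ω₀ j) := by
  have hc : ∀ ω : Ω, Continuous fun y : N → Belief Ω => ENNReal.ofReal ((y j.1).1 ω) := fun ω =>
    ENNReal.continuous_ofReal.comp
      ((continuous_apply ω).comp (continuous_subtype_val.comp (continuous_apply j.1)))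
  exact (hc j.2).lowerSemicontinuous.ennreal_mul (continuous_inv.comp (hc ω₀)).lowerSemicontinuous

omit [Fintype N] in
theorem oneStateFeasible_eq (B : Problem Ω N) (ω₀ : Ω) :
    B.oneStateFeasible ω₀ = momentFeasible (ratio ω₀) (B.ratioBound ω₀) := by
  ext π
  refine and_congr_right fun _ => ⟨fun h j => ?_, fun h i ω hω => ?_⟩
  · exact (ratioIntegral_eq ω₀ π j.1 j.2).symm.trans_le (h j.1 j.2 j.2.2)
  · exact (ratioIntegral_eq ω₀ π i ω).trans_le (h (i, ⟨ω, hω⟩))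

theorem sum_activeCount (B : Problem Ω N) (ω₀ : Ω) (π : Measure (N → Belief Ω)) :
    (activeConstraints (ratio ω₀) (B.ratioBound ω₀) π).ncard = ∑ i, B.activeCount ω₀ π i := by
  classical
  let e : activeConstraints (ratio ω₀) (B.ratioBound ω₀) π ≃
      Σ i : N, {ω | ω ≠ ω₀ ∧ ratioIntegral ω₀ π i ω =
        ENNReal.ofReal (B.prior.1 ω / B.prior.1 ω₀)} :=
    { toFun := fun j => ⟨j.1.1, j.1.2, j.1.2.2, (ratioIntegral_eq ω₀ π _ _).trans j.2⟩
      invFun := fun k => ⟨(k.1, ⟨k.2.1, k.2.2.1⟩), (ratioIntegral_eq ω₀ π _ _).symm.trans k.2.2.2⟩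
      left_inv := fun _ => rfl
      right_inv := fun _ => rfl }
  rw [← Nat.card_coe_set_eq, Nat.card_congr e, Nat.card_sigma]
  exact Finset.sum_congr rfl fun i _ => Nat.card_coe_set_eq _

theorem encard_support_le_of_extreme (B : Problem Ω N) (ω₀ : Ω) {π : Measure (N → Belief Ω)}
    (hπ : π ∈ Set.extremePoints ℝ≥0 (B.oneStateFeasible ω₀)) :
    π.support.encard ≤ ((∑ i, B.activeCount ω₀ π i + 1 : ℕ) : ℕ∞) := by
  rw [oneStateFeasible_eq] at hπ
  rw [← sum_activeCount]
  exact encard_support_le_of_mem_extremePoints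
    (fun j => (lowerSemicontinuous_ratio ω₀ j).measurable) (fun _ => ENNReal.ofReal_ne_top) hπ

-- Revealing nothing is feasible, so the maximum is over a nonempty set and is not `-∞`.
omit [Fintype N] in
theorem dirac_prior_mem (B : Problem Ω N) (ω₀ : Ω) :
    Measure.dirac (fun _ : N => B.prior) ∈ B.oneStateFeasible ω₀ := by
  refine ⟨inferInstance, fun i ω _ => ?_⟩
  rw [ratioIntegral_eq, lintegral_dirac' _
      (f := fun y : N → Belief Ω => ENNReal.ofReal ((y i).1 ω) / ENNReal.ofReal ((y i).1 ω₀))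
      ((measurable_ratio ω₀ ω).comp (measurable_pi_apply i)), ENNReal.ofReal_div_of_pos (B.prior_pos ω₀)]

/-- The sender's maximal utility over the feasible laws is a real number, attained by a law with
few atoms. -/
theorem exists_optimal (B : Problem Ω N) (ω₀ : Ω) :
    ∃ π ∈ B.oneStateFeasible ω₀,
      π.support.encard ≤ ((∑ i, B.activeCount ω₀ π i + 1 : ℕ) : ℕ∞) ∧
      ∃ m : ℝ, extIntegral π (B.utility ω₀) = (m : EReal) ∧
        ∀ π' ∈ B.oneStateFeasible ω₀, extIntegral π' (B.utility ω₀) ≤ (m : EReal) := by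
  obtain ⟨C, hC0, hC⟩ := B.exists_utility_le ω₀
  have hv := B.measurable_utility ω₀
  -- Subtracting `v` from an upper bound gives a nonnegative lower semicontinuous cost, to be
  -- minimised.
  have hg : LowerSemicontinuous fun x => ENNReal.ofReal (C - B.utility ω₀ x) :=
    (ENNReal.continuous_ofReal.comp (continuous_const.sub continuous_id) :
      Continuous fun t : ℝ => ENNReal.ofReal (C - t)).comp_upperSemicontinuous_antitone (B.usc ω₀)
        fun s t hst => ENNReal.ofReal_le_ofReal (sub_le_sub_left hst C)
  have h₀ := B.dirac_prior_mem ω₀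
  have hg₀ : ∫⁻ x, ENNReal.ofReal (C - B.utility ω₀ x)
      ∂(Measure.dirac fun _ : N => B.prior) ≠ ∞ := by
    rw [lintegral_dirac' _ hg.measurable]
    exact ENNReal.ofReal_ne_top
  rw [oneStateFeasible_eq] at h₀ ⊢
  obtain ⟨π, hπ, hsupp, hmin⟩ := exists_momentFeasible_minimizer (lowerSemicontinuous_ratio ω₀)
    (c := B.ratioBound ω₀) (fun _ => ENNReal.ofReal_ne_top) hg ⟨_, h₀, hg₀⟩
  have hfin := ne_top_of_le_ne_top hg₀ (hmin _ h₀)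
  have hm : (((C - (∫⁻ x, ENNReal.ofReal (C - B.utility ω₀ x) ∂π).toReal : ℝ)) : EReal) =
      (C : EReal) - ((∫⁻ x, ENNReal.ofReal (C - B.utility ω₀ x) ∂π : ℝ≥0∞) : EReal) := by
    rw [EReal.coe_sub, EReal.coe_ennreal_toReal hfin]
  rw [sum_activeCount] at hsupp
  refine ⟨π, hπ, hsupp, C - (∫⁻ x, ENNReal.ofReal (C - B.utility ω₀ x) ∂π).toReal, ?_,
    fun π' hπ' => ?_⟩
  · have := hπ.1
    rw [extIntegral_eq_sub hv hC0 hC, hm]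
  · have := hπ'.1
    rw [extIntegral_eq_sub hv hC0 hC, hm]
    exact EReal.sub_le_sub le_rfl (EReal.coe_ennreal_le_coe_ennreal_iff.2 (hmin π' hπ'))

end Problem

end Persuasion

/-! ### The main theorem -/

theorem mainTheorem5 {Ω : Type u} [Fintype Ω] [Nonempty Ω] [MeasurableSpace Ω]
    [DiscreteMeasurableSpace Ω] {N : Type v} [Fintype N]
    (B : Persuasion.Problem Ω N) (ω₀ : Ω) (hB : B.IsOneState ω₀) :
    -- the maximum of `∫ v dπ` is a real number `m`, and the value is `p(ω₀) * m`
    (∃ m : ℝ,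
      Persuasion.Problem.value.{u, v, w} B = ((B.prior.1 ω₀ * m : ℝ) : EReal) ∧
      (∃ I : Persuasion.InfoStructure.{u, v, w} Ω N,
        B.expectedUtility I = Persuasion.Problem.value.{u, v, w} B) ∧
      -- over all feasible `π`
      IsGreatest ((fun π => Persuasion.extIntegral π (B.utility ω₀)) ''
        B.oneStateFeasible ω₀) (m : EReal) ∧
      -- over the feasible `π` with at most `|N| (|Ω| - 1) + 1` atoms
      IsGreatest ((fun π => Persuasion.extIntegral π (B.utility ω₀)) ''
        {π ∈ B.oneStateFeasible ω₀ |
          π.support.encard ≤ ((Fintype.card N * (Fintype.card Ω - 1) + 1 : ℕ) : ℕ∞)})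
        (m : EReal) ∧
      -- over the feasible `π` with at most `n(π) + 1` atoms
      IsGreatest ((fun π => Persuasion.extIntegral π (B.utility ω₀)) ''
        {π ∈ B.oneStateFeasible ω₀ |
          π.support.encard ≤ ((∑ i, B.activeCount ω₀ π i + 1 : ℕ) : ℕ∞)})
        (m : EReal)) ∧
    -- the extreme feasible `π` have at most `n(π) + 1` atoms
    (∀ π ∈ Set.extremePoints ℝ≥0 (B.oneStateFeasible ω₀),
      π.support.encard ≤ ((∑ i, B.activeCount ω₀ π i + 1 : ℕ) : ℕ∞)) ∧
    -- feasible `π` with finitely many atoms are implemented with few signals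
    (∀ π ∈ B.oneStateFeasible ω₀, π.support.Finite →
      ∃ I : Persuasion.InfoStructure.{u, v, w} Ω N,
        I.UsesAtMost (fun i => (π.map (fun y => y i)).support.ncard +
          (Fintype.card Ω - 1 - B.activeCount ω₀ π i)) ∧
        I.beliefLaw B.prior ω₀ = π ∧
        B.expectedUtility I =
          (B.prior.1 ω₀ : EReal) * Persuasion.extIntegral π (B.utility ω₀)) ∧
    -- those with at most `n(π) + 1` atoms need at most `|N| (|Ω| - 1) + 1` signals per receiver
    (∀ π ∈ B.oneStateFeasible ω₀,
      π.support.encard ≤ ((∑ i, B.activeCount ω₀ π i + 1 : ℕ) : ℕ∞) →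
      ∃ I : Persuasion.InfoStructure.{u, v, w} Ω N,
        I.UsesAtMost (fun _ => Fintype.card N * (Fintype.card Ω - 1) + 1) ∧
        I.beliefLaw B.prior ω₀ = π ∧
        B.expectedUtility I =
          (B.prior.1 ω₀ : EReal) * Persuasion.extIntegral π (B.utility ω₀)) := by
  have hact : ∀ π : MeasureTheory.Measure (N → Persuasion.Belief Ω),
      ∑ i, B.activeCount ω₀ π i + 1 ≤ Fintype.card N * (Fintype.card Ω - 1) + 1 := by
    intro π
    have := Finset.sum_le_card_nsmul Finset.univ (fun i => B.activeCount ω₀ π i) _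
      fun i _ => B.activeCount_le ω₀ π i
    rw [Finset.card_univ, smul_eq_mul] at this
    omega
  obtain ⟨π, hπ, hsupp, m, hm, hmax⟩ := B.exists_optimal ω₀
  -- One maximiser with at most `n(π) + 1` atoms lies in all three sets, so it serves for all three
  -- maxima.
  have hub : ∀ Q : Set (MeasureTheory.Measure (N → Persuasion.Belief Ω)),
      Q ⊆ B.oneStateFeasible ω₀ → π ∈ Q →
      IsGreatest ((fun π => Persuasion.extIntegral π (B.utility ω₀)) '' Q) (m : EReal) := by
    refine fun Q hQ hπQ => ⟨⟨π, hπQ, hm⟩, ?_⟩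
    rintro _ ⟨π', hπ', rfl⟩
    exact hmax π' (hQ hπ')
  refine ⟨⟨m, ?_⟩, fun π hπ => B.encard_support_le_of_extreme ω₀ hπ, fun π hπ hfin => ?_,
    fun π hπ hsupp => ?_⟩
  · obtain ⟨I, -, hI⟩ := B.exists_infoStructure.{u, v, w} ω₀ hπ
      (Set.finite_of_encard_le_coe hsupp)
    have hIu : B.expectedUtility I = ((B.prior.1 ω₀ * m : ℝ) : EReal) := by
      rw [hB.expectedUtility_eq, hI, hm, EReal.coe_mul]
    have hval : Persuasion.Problem.value.{u, v, w} B = ((B.prior.1 ω₀ * m : ℝ) : EReal) := by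
      refine le_antisymm (iSup_le fun I' => ?_) (hIu ▸ le_iSup B.expectedUtility I)
      rw [hB.expectedUtility_eq, EReal.coe_mul]
      exact mul_le_mul_of_nonneg_left (hmax _ (B.beliefLaw_mem_oneStateFeasible ω₀ I'))
        (EReal.coe_nonneg.2 (B.prior_pos ω₀).le)
    exact ⟨hval, ⟨I, hIu.trans hval.symm⟩, hub _ subset_rfl hπ,
      hub _ (fun _ h => h.1) ⟨hπ, hsupp.trans (by exact_mod_cast hact π)⟩,
      hub _ (fun _ h => h.1) ⟨hπ, hsupp⟩⟩
  · obtain ⟨I, hI, hlaw⟩ := B.exists_infoStructure.{u, v, w} ω₀ hπ hfin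
    exact ⟨I, hI, hlaw, by rw [hB.expectedUtility_eq, hlaw]⟩
  · obtain ⟨I, hI, hlaw⟩ := B.exists_infoStructure.{u, v, w} ω₀ hπ
      (Set.finite_of_encard_le_coe hsupp)
    exact ⟨I, fun i => ⟨(hI i).1, (hI i).2.1, (hI i).2.2.trans (B.signal_bound ω₀ hsupp i)⟩,
      hlaw, by rw [hB.expectedUtility_eq, hlaw]⟩
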